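/- Let $k$ be a field, $n\ge 1$, and let $Q$ be a quiver of type $\mathbb{A}_n$: its vertices are $1,\dots,n$, and for each $1\le i<n$ there is exactly one arrow between $i$ and $i+1$, in one of the two directions, and there are no other arrows. A module is a finite-dimensional representation of $Q$ over $k$; for a module $M$ let $\underline{\dim}\,M=(\dim M_1,\dots,\dim M_n)\in\mathbb{R}^n$ and let $\operatorname{supp}M$ be the set of vertices $i$ with $M_i\neq 0$. For a full subquiver $Q'$ of $Q$ with $m\ge 0$ vertices, a tilting module over $Q'$ is a module $T=\bigoplus_{i=1}^{m}T(i)$ over $Q'$ with $T(i)$ indecomposable and pairwise non-isomorphic, and $\mathrm{Ext}^1(T,T)=0$. A support tilting module is a module over $Q$ whose restriction to its support is a tilting module (over the full subquiver on the support; the zero module is included). A $2$-support tilting module is a pair $(T^+,T^-)$ of support tilting modules whose supports are disjoint with union $\{1,\dots,n\}$. Write $e_1,\dots,e_n$ for the standard basis of $\mathbb{R}^n$, and $D(M)$ for the set of dimension vectors of the indecomposable direct summands of $M$. Put $$P^+(Q)=\bigcup_{T\ \text{tilting}}\operatorname{conv}\bigl(D(T)\cup\{0\}\bigr),$$ $$P^{\mathrm{clus}}(Q)=\bigcup_{T\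 \text{support tilting}}\operatorname{conv}\bigl(D(T)\cup\{-e_j: j\notin\operatorname{supp}T\}\cup\{0\}\bigr),$$ $$P(Q)=\bigcup_{(T^+,T^-)\ 2\text{-support tilting}}\operatorname{conv}\bigl(D(T^+)\cup(-D(T^-))\cup\{0\}\bigr).$$ Let $\Phi^+=\{e_i+e_{i+1}+\dots+e_j : 1\le i\le j\le n\}$ be the set of positive roots of type $\mathbb{A}_n$ in the coordinates of the simple roots $e_1,\dots,e_n$, and put $$C^+(Q)=\operatorname{conv}(\Phi^+\cup\{0\}),\quad C^{\mathrm{clus}}(Q)=\operatorname{conv}(\Phi^+\cup\{-e_1,\dots,-e_n\}),\quad C(Q)=\operatorname{conv}(\Phi^+\cup-\Phi^+).$$ Then $$C(Q)=P(Q),\qquad C^{\mathrm{clus}}(Q)=P^{\mathrm{clus}}(Q),\qquad C^+(Q)=P^+(Q).$$ In particular $P(Q)$, $P^{\mathrm{clus}}(Q)$ and $P^+(Q)$ do not depend on the orientation of $Q$. -/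

import Mathlib

open CategoryTheory CategoryTheory.Limits

universe u v v' w

noncomputable section

namespace QuiverTilting

/-- A quiver on the vertices `0, …, n - 1` is of type `A_n` (with some orientation) if every arrow
joins two consecutive vertices, and between any two consecutive vertices there is exactly one arrow,
in one of the two directions. -/
structure IsTypeA {n : ℕ} (Q : Quiver.{v} (Fin n)) : Prop where
  adjacent : ∀ i j : Fin n, Nonempty (Q.Hom i j) →
    (i : ℕ) + 1 = (j : ℕ) ∨ (j : ℕ) + 1 = (i : ℕ)
  existsUnique_arrow : ∀ i j : Fin n, (i : ℕ) + 1 = (j : ℕ) →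
    Nonempty (Unique (Q.Hom i j ⊕ Q.Hom j i))

section Representations

variable (k : Type u) [Field k] {V : Type w}

/-- The abelian category of `k`-linear representations of the quiver `Q`, as functors on its path
category: a vector space for every vertex and a linear map for every arrow. -/
abbrev QRep (Q : Quiver.{v} V) : Type _ :=
  Paths V ⥤ ModuleCat.{u} k

variable {k} {Q : Quiver.{v} V}

/-- The vector space of a representation at a vertex. -/
abbrev QRep.space (M : QRep k Q) (i : V) : ModuleCat.{u} k :=
  M.obj ((Paths.of V).obj i)

/-- The representation is finite dimensional at every vertex. -/
def IsFinDim (M : QRep k Q) : Prop :=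
  ∀ i : V, FiniteDimensional k (M.space i)

/-- The dimension vector of a representation. -/
def dimVec (M : QRep k Q) (i : V) : ℕ :=
  Module.finrank k (M.space i)

/-- The dimension vector, as a point of the real vector space with coordinates indexed by the
vertices. -/
def realDimVec (M : QRep k Q) (i : V) : ℝ :=
  (dimVec M i : ℝ)

/-- The support of a representation is the support of its dimension vector. -/
def supp (M : QRep k Q) : Set V :=
  {i | dimVec M i ≠ 0}

/-- A representation is rigid if `Ext¹(M, M) = 0` in the category of representations. -/
def IsRigid (M : QRep k Q) : Prop :=
  letI : HasExt (QRep k Q) := HasExt.standard (QRep k Q)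
  Subsingleton (Abelian.Ext M M 1)

/-- `N` is an indecomposable direct summand of `M`. -/
def IsIndecSummand (N M : QRep k Q) : Prop :=
  Indecomposable N ∧ ∃ N' : QRep k Q, Nonempty (M ≅ N ⊞ N')

/-- A tilting module: a finite dimensional module with `Ext¹(T, T) = 0` which is the direct sum of
as many pairwise non-isomorphic indecomposable modules as there are vertices. -/
def IsTilting (T : QRep k Q) : Prop :=
  haveI : HasFiniteBiproducts (QRep k Q) := Abelian.hasFiniteBiproducts
  IsFinDim T ∧ IsRigid T ∧
    ∃ X : Fin (Nat.card V) → QRep k Q,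
      (∀ i, Indecomposable (X i)) ∧ (∀ i j, i ≠ j → IsEmpty (X i ≅ X j)) ∧ Nonempty (T ≅ ⨁ X)

/-- The full subquiver on a set of vertices. -/
abbrev fullSubquiver (Q : Quiver.{v} V) (S : Set V) : Quiver.{v} S :=
  ⟨fun i j => Q.Hom i.1 j.1⟩

/-- The inclusion of the path category of a full subquiver. -/
def pathsInclusion (Q : Quiver.{v} V) (S : Set V) :
    @Functor (@Paths S) (@Paths.categoryPaths S (fullSubquiver Q S)) (Paths V) _ :=
  letI := fullSubquiver Q S
  Paths.lift { obj := fun i => (Paths.of V).obj i.1, map := fun {i j} (f : Q.Hom i.1 j.1) =>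
    (Paths.of V).map f }

/-- The restriction of a representation to the full subquiver on a set of vertices. -/
def restrict (M : QRep k Q) (S : Set V) : QRep k (fullSubquiver Q S) :=
  letI := fullSubquiver Q S
  pathsInclusion Q S ⋙ M

/-- A support tilting module: a finite dimensional module whose restriction to its support is a
tilting module. -/
def IsSupportTilting (T : QRep k Q) : Prop :=
  IsFinDim T ∧ IsTilting (restrict T (supp T))

/-- A 2-support tilting module `T = T⁺ ⊕ T⁻`, given by its two parts: both are support tilting and
the set of vertices is the disjoint union of their supports. -/
def IsTwoSupportTilting (Tpos Tneg : QRep k Q) : Prop :=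
  IsSupportTilting Tpos ∧ IsSupportTilting Tneg ∧ IsCompl (supp Tpos) (supp Tneg)

/-- The dimension vectors of the indecomposable direct summands of `M`. -/
def summandDims (M : QRep k Q) : Set (V → ℝ) :=
  {d | ∃ N : QRep k Q, IsIndecSummand N M ∧ d = realDimVec N}

/-- The negatives of the standard basis vectors at the vertices outside `S`. -/
def negBasisOutside (S : Set V) : Set (V → ℝ) :=
  {d | ∃ j : V, j ∉ S ∧ d = -Set.indicator {j} 1}

/-- The simplex `σ_T` of a tilting module. -/
def simplexPlus (T : QRep k Q) : Set (V → ℝ) :=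
  convexHull ℝ (summandDims T ∪ {0})

/-- The simplex `σ_T` of a support tilting module. -/
def simplexClus (T : QRep k Q) : Set (V → ℝ) :=
  convexHull ℝ (summandDims T ∪ negBasisOutside (supp T) ∪ {0})

/-- The simplex `σ_T` of a 2-support tilting module `T = T⁺ ⊕ T⁻`. -/
def simplexTwo (Tpos Tneg : QRep k Q) : Set (V → ℝ) :=
  convexHull ℝ (summandDims Tpos ∪ {d | -d ∈ summandDims Tneg} ∪ {0})

variable (k) (Q)

/-- `P⁺(Q)`, the union of the simplices of all tilting modules. -/
def polyPPlus : Set (V → ℝ) :=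
  {x | ∃ T : QRep k Q, IsTilting T ∧ x ∈ simplexPlus T}

/-- `P^clus(Q)`, the union of the simplices of all support tilting modules. -/
def polyPClus : Set (V → ℝ) :=
  {x | ∃ T : QRep k Q, IsSupportTilting T ∧ x ∈ simplexClus T}

/-- `P(Q)`, the union of the simplices of all 2-support tilting modules. -/
def polyP : Set (V → ℝ) :=
  {x | ∃ Tpos Tneg : QRep k Q, IsTwoSupportTilting Tpos Tneg ∧ x ∈ simplexTwo Tpos Tneg}

end Representations

/-- The positive roots of type `A_n` in the coordinates of the simple roots: the vectors
`(0, …, 0, 1, …, 1, 0, …, 0)` whose entries `1` fill a nonempty interval `[i, j]`. -/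
def posRoots (n : ℕ) : Set (Fin n → ℝ) :=
  {d | ∃ i j : Fin n, i ≤ j ∧ d = Set.indicator (Set.Icc i j) 1}

/-- The simple roots of type `A_n`: the standard basis vectors. -/
def simpleRoots (n : ℕ) : Set (Fin n → ℝ) :=
  {d | ∃ i : Fin n, d = Pi.single i 1}

/-- `C⁺(A_n)`, the convex hull of the positive roots and `0`. -/
def polyCPlus (n : ℕ) : Set (Fin n → ℝ) :=
  convexHull ℝ (posRoots n ∪ {0})

/-- `C^clus(A_n)`, the convex hull of the positive roots and the negative simple roots. -/
def polyCClus (n : ℕ) : Set (Fin n → ℝ) :=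
  convexHull ℝ (posRoots n ∪ {d | -d ∈ simpleRoots n})

/-- `C(A_n)`, the convex hull of all roots. -/
def polyC (n : ℕ) : Set (Fin n → ℝ) :=
  convexHull ℝ (posRoots n ∪ {d | -d ∈ posRoots n})

end QuiverTilting

end

/-!
By Gabriel's theorem the indecomposable modules are the interval modules, so all the simplices have
roots as vertices, which gives one inclusion. For the other one, let `S` be the set of vertices at
which `x` is nonnegative. Vertex by vertex, a greedy choice writes the restriction of `x` to `S` as
a nonnegative combination of the indicator vectors of a family of intervals without extensions
which has as many members as `S`; the sum of these interval modules is support tilting with support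
`S`. The restriction of `-x` to the complement of `S` is treated in the same way, or expanded in
the standard basis. A linear functional which is `1` on all the vectors so obtained and at most `1`
on all the roots then shows that the coefficients sum up to at most `1`.
-/

noncomputable section

namespace QuiverTilting

section ExtOne

universe w₁ v₁ u₁

variable {C : Type u₁} [Category.{v₁} C] [Abelian C]
open Abelian Pretriangulated

open DerivedCategory in
lemma exists_distinguished_singleFunctor [HasDerivedCategory.{w₁} C] {X Y : C}
    (δ : (singleFunctor C 0).obj X ⟶ ((singleFunctor C 0).obj Y)⟦(1 : ℤ)⟧) :
    ∃ (E : C) (f : Y ⟶ E) (g : E ⟶ X),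
      Triangle.mk ((singleFunctor C 0).map f) ((singleFunctor C 0).map g) δ ∈ distTriang _ := by
  let F := singleFunctor C 0
  obtain ⟨Z, f, g, hT⟩ := distinguished_cocone_triangle₂ δ
  have : Z.IsGE 0 := TStructure.t.isGE₂ _ hT 0
    (inferInstanceAs ((F.obj Y).IsGE 0)) (inferInstanceAs ((F.obj X).IsGE 0))
  have : Z.IsLE 0 := TStructure.t.isLE₂ _ hT 0
    (inferInstanceAs ((F.obj Y).IsLE 0)) (inferInstanceAs ((F.obj X).IsLE 0))
  obtain ⟨E, ⟨e⟩⟩ := exists_iso_singleFunctor_obj_of_isGE_of_isLE Z 0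
  refine ⟨E, F.preimage (f ≫ e.hom), F.preimage (e.inv ≫ g), isomorphic_distinguished _ hT _
    (Triangle.isoMk _ _ (Iso.refl (F.obj Y)) e.symm (Iso.refl (F.obj X)) ?_ ?_ ?_)⟩
  · change F.map (F.preimage (f ≫ e.hom)) ≫ e.inv = 𝟙 _ ≫ f
    simp
  · change F.map (F.preimage (e.inv ≫ g)) ≫ 𝟙 _ = e.inv ≫ g
    simp
  · change δ ≫ (𝟙 (F.obj Y))⟦(1 : ℤ)⟧' = 𝟙 _ ≫ δ
    rw [CategoryTheory.Functor.map_id]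
    exact (Category.comp_id δ).trans (Category.id_comp δ).symm

open DerivedCategory in
lemma shortExact_of_distinguished_singleFunctor [HasDerivedCategory.{w₁} C] {X Y E : C}
    {f : Y ⟶ E} {g : E ⟶ X} {δ : (singleFunctor C 0).obj X ⟶ ((singleFunctor C 0).obj Y)⟦(1 : ℤ)⟧}
    (hT : Triangle.mk ((singleFunctor C 0).map f) ((singleFunctor C 0).map g) δ ∈ distTriang _) :
    ∃ w : f ≫ g = 0, (ShortComplex.mk f g w).ShortExact := by
  let H := singleFunctor C 0 ⋙ homologyFunctor C 0
  have hmono : Mono (H.map f) := (HomologySequence.mono_homologyMap_mor₁_iff _ hT (-1) 0).2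
    ((isZero_of_isGE ((singleFunctor C 0).obj X) 0 (-1) (by lia)).eq_of_src _ _)
  have hepi : Epi (H.map g) := (HomologySequence.epi_homologyMap_mor₂_iff _ hT 0 1).2
    ((isZero_of_isLE ((singleFunctor C 0).obj Y) 0 1 (by lia)).eq_of_tgt _ _)
  have hexact := HomologySequence.exact₂ _ hT 0
  have w : f ≫ g = 0 := by
    apply (singleFunctor C 0).map_injective
    rw [Functor.map_comp, Functor.map_zero]
    exact comp_distTriang_mor_zero₁₂ _ hT
  refine ⟨w, ?_⟩
  let φ := (ShortComplex.mk f g w).mapNatIso (singleFunctorCompHomologyFunctorIso C 0)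
  exact ShortComplex.shortExact_of_iso φ { exact := hexact, mono_f := hmono, epi_g := hepi }

lemma exists_shortExact_of_ext_one [HasExt.{w₁} C] {X Y : C} (e : Ext X Y 1) :
    ∃ (E : C) (f : Y ⟶ E) (g : E ⟶ X) (w : f ≫ g = 0),
      (ShortComplex.mk f g w).ShortExact ∧ e.comp (Ext.mk₀ f) (add_zero 1) = 0 := by
  let := HasDerivedCategory.standard C
  obtain ⟨E, f, g, hT⟩ := exists_distinguished_singleFunctor e.hom
  obtain ⟨w, hw⟩ := shortExact_of_distinguished_singleFunctor hT
  refine ⟨E, f, g, w, hw, Ext.ext ?_⟩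
  rw [Ext.zero_hom, Ext.comp_hom, Ext.mk₀_hom, ShiftedHom.comp_mk₀]
  exact comp_distTriang_mor_zero₃₁ _ hT

lemma subsingleton_ext_one_of_forall_retraction [HasExt.{w₁} C] {X Y : C}
    (H : ∀ (E : C) (f : Y ⟶ E) (g : E ⟶ X) (w : f ≫ g = 0),
      (ShortComplex.mk f g w).ShortExact → ∃ r : E ⟶ Y, f ≫ r = 𝟙 Y) :
    Subsingleton (Ext.{w₁} X Y 1) := by
  refine subsingleton_of_forall_eq 0 fun e => ?_
  obtain ⟨E, f, g, w, hw, hef⟩ := exists_shortExact_of_ext_one e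
  obtain ⟨r, hr⟩ := H E f g w hw
  calc e = (e.comp (Ext.mk₀ f) (add_zero 1)).comp (Ext.mk₀ r) (add_zero 1) := by
        rw [Ext.comp_assoc_of_third_deg_zero, Ext.mk₀_comp_mk₀, hr, Ext.comp_mk₀_id]
    _ = 0 := by rw [hef, Ext.zero_comp]

end ExtOne

section Representations

variable {k : Type u} [Field k] {V : Type w} {Q : Quiver.{v} V}

namespace QRep

/-- The linear map of a representation at an arrow. -/
def arrowMap (M : QRep k Q) {i j : V} (f : Q.Hom i j) : M.space i →ₗ[k] M.space j :=
  (M.map ((Paths.of V).map f)).hom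

/-- The linear map of a morphism of representations at a vertex. -/
def homAt {M N : QRep k Q} (α : M ⟶ N) (i : V) : M.space i →ₗ[k] N.space i :=
  (α.app ((Paths.of V).obj i)).hom

lemma homAt_arrowMap {M N : QRep k Q} (α : M ⟶ N) {i j : V} (f : Q.Hom i j) (x : M.space i) :
    homAt α j (M.arrowMap f x) = N.arrowMap f (homAt α i x) :=
  LinearMap.congr_fun (congrArg ModuleCat.Hom.hom (α.naturality ((Paths.of V).map f))) x

/-- The morphism of representations given by linear maps at the vertices that commute with the
linear maps at the arrows. -/
def mkHom {M N : QRep k Q} (φ : ∀ i, M.space i →ₗ[k] N.space i)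
    (h : ∀ (i j : V) (f : Q.Hom i j) (x : M.space i),
      φ j (M.arrowMap f x) = N.arrowMap f (φ i x)) : M ⟶ N :=
  Paths.liftNatTrans (fun i => ModuleCat.ofHom (φ i)) fun {i j} f => by
    ext x
    exact h i j f x

@[simp]
lemma homAt_mkHom {M N : QRep k Q} (φ : ∀ i, M.space i →ₗ[k] N.space i)
    (h : ∀ (i j : V) (f : Q.Hom i j) (x : M.space i),
      φ j (M.arrowMap f x) = N.arrowMap f (φ i x)) (i : V) :
    homAt (mkHom φ h) i = φ i := rfl

@[simp]
lemma homAt_comp {M N L : QRep k Q} (α : M ⟶ N) (β : N ⟶ L) (i : V) (x : M.space i) :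
    homAt (α ≫ β) i x = homAt β i (homAt α i x) := rfl

@[simp]
lemma homAt_id (M : QRep k Q) (i : V) (x : M.space i) : homAt (𝟙 M) i x = x := rfl

@[simp]
lemma homAt_zero (M N : QRep k Q) (i : V) (x : M.space i) : homAt (0 : M ⟶ N) i x = 0 := rfl

lemma hom_ext {M N : QRep k Q} {α β : M ⟶ N} (h : ∀ i x, homAt α i x = homAt β i x) : α = β := by
  apply NatTrans.ext
  funext i
  exact ModuleCat.hom_ext (LinearMap.ext (h i))

lemma shortExact_at {S : ShortComplex (QRep k Q)} (hS : S.ShortExact) (i : V) :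
    Function.Injective (homAt S.f i) ∧ Function.Surjective (homAt S.g i) ∧
      Function.Exact (homAt S.f i) (homAt S.g i) := by
  have h := hS.map_of_exact ((evaluation (Paths V) (ModuleCat.{u} k)).obj ((Paths.of V).obj i))
  exact ⟨h.moduleCat_injective_f, h.moduleCat_surjective_g,
    (ShortComplex.ShortExact.moduleCat_exact_iff_function_exact _).1 h.exact⟩

/-- The extension is split at every vertex by `r`, and the failure of `r` to commute with the arrows
is a cochain that factors through the quotient; a potential for it corrects `r`. -/
lemma exists_retraction_of_forall_coboundary {M N E : QRep k Q} {f : N ⟶ E} {g : E ⟶ M}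
    {w : f ≫ g = 0} (hS : (ShortComplex.mk f g w).ShortExact)
    (H : ∀ h : (∀ i j : V, Q.Hom i j → (M.space i →ₗ[k] N.space j)),
      ∃ φ : ∀ i, M.space i →ₗ[k] N.space i, ∀ (i j : V) (a : Q.Hom i j) (x : M.space i),
        h i j a x = N.arrowMap a (φ i x) - φ j (M.arrowMap a x)) :
    ∃ r : E ⟶ N, f ≫ r = 𝟙 N := by
  have hex := shortExact_at hS
  choose r hr using fun i => LinearMap.exists_leftInverse_of_injective (homAt f i)
    (LinearMap.ker_eq_bot.2 (hex i).1)
  choose s hs using fun i => LinearMap.exists_rightInverse_of_surjective (homAt g i)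
    (LinearMap.range_eq_top.2 (hex i).2.1)
  replace hr : ∀ i x, r i (homAt f i x) = x := fun i => LinearMap.congr_fun (hr i)
  replace hs : ∀ i x, homAt g i (s i x) = x := fun i => LinearMap.congr_fun (hs i)
  have hfg : ∀ i x, homAt g i (homAt f i x) = 0 := fun i => (hex i).2.2.apply_apply_eq_zero
  obtain ⟨φ, hφ⟩ := H fun i j a => (r j ∘ₗ E.arrowMap a - N.arrowMap a ∘ₗ r i) ∘ₗ s i
  have defect_eq (i j : V) (a : Q.Hom i j) (x : E.space i) :
      r j (E.arrowMap a x) - N.arrowMap a (r i x) =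
        N.arrowMap a (φ i (homAt g i x)) - φ j (homAt g j (E.arrowMap a x)) := by
    obtain ⟨y, hy⟩ := ((hex i).2.2 (x - s i (homAt g i x))).1 (by simp [hs])
    obtain ⟨z, rfl⟩ : ∃ z, x = homAt f i y + s i z := ⟨_, (sub_eq_iff_eq_add.1 hy.symm)⟩
    rw [homAt_arrowMap, ← hφ]
    simp [← homAt_arrowMap, hr, hs, hfg]
  refine ⟨mkHom (fun i => r i + φ i ∘ₗ homAt g i) fun i j a x => ?_, hom_ext fun i x => ?_⟩
  · simpa only [LinearMap.add_apply, LinearMap.comp_apply, map_add, add_comm] using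
      sub_eq_sub_iff_add_eq_add.1 (defect_eq i j a x)
  · simp [hr, hfg]

lemma subsingleton_ext_one [HasExt.{v'} (QRep k Q)] {M N : QRep k Q}
    (H : ∀ h : (∀ i j : V, Q.Hom i j → (M.space i →ₗ[k] N.space j)),
      ∃ φ : ∀ i, M.space i →ₗ[k] N.space i, ∀ (i j : V) (a : Q.Hom i j) (x : M.space i),
        h i j a x = N.arrowMap a (φ i x) - φ j (M.arrowMap a x)) :
    Subsingleton (Abelian.Ext M N 1) :=
  subsingleton_ext_one_of_forall_retraction fun _ _ _ _ hS =>
    exists_retraction_of_forall_coboundary hS H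

end QRep

lemma dimVec_eq_of_iso {M N : QRep k Q} (e : M ≅ N) : dimVec M = dimVec N :=
  funext fun i => (e.app ((Paths.of V).obj i)).toLinearEquiv.finrank_eq

lemma IsFinDim.of_iso {M N : QRep k Q} (hM : IsFinDim M) (e : M ≅ N) : IsFinDim N := fun i =>
  have := hM i
  Module.Finite.equiv (e.app ((Paths.of V).obj i)).toLinearEquiv

end Representations

section ThinRepresentations

variable {k : Type u} [Field k] {V : Type w} {Q : Quiver.{v} V}

open Classical in
/-- The coordinate on the space of functions on a proposition, which is `0` if the proposition
fails. -/
def thinCoord (k : Type u) [Field k] (p : Prop) : (PLift p → k) →ₗ[k] k :=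
  if h : p then LinearMap.proj ⟨h⟩ else 0

/-- The constant functions on a proposition. -/
def thinConst (k : Type u) [Field k] (p : Prop) : k →ₗ[k] (PLift p → k) :=
  LinearMap.pi fun _ => LinearMap.id

variable (k Q) in
/-- The thin representation on a set of vertices: one-dimensional at these vertices, zero
elsewhere, with identities along the arrows between them. The spaces `PLift (i ∈ I) → k` make this
a definition without case distinction on `i ∈ I`. -/
def thinRep (I : Set V) : QRep k Q :=
  Paths.lift
    { obj := fun i => ModuleCat.of k (PLift (i ∈ I) → k)
      map := fun {i j} _ => ModuleCat.ofHom (thinConst k (j ∈ I) ∘ₗ thinCoord k (i ∈ I)) }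

/-- The coordinate of a thin representation at a vertex. -/
def coordAt (I : Set V) (i : V) : (thinRep k Q I).space i →ₗ[k] k := thinCoord k (i ∈ I)

/-- The element of a thin representation at a vertex with given coordinate. -/
def constAt (I : Set V) (i : V) : k →ₗ[k] (thinRep k Q I).space i := thinConst k (i ∈ I)

lemma thinRep_arrowMap (I : Set V) {i j : V} (f : Q.Hom i j) (x : (thinRep k Q I).space i) :
    (thinRep k Q I).arrowMap f x = constAt I j (coordAt I i x) := by
  unfold QRep.arrowMap thinRep
  erw [Paths.lift_toPath]
  rfl

open Classical in
lemma coordAt_constAt (I : Set V) (i : V) (c : k) :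
    coordAt (Q := Q) I i (constAt I i c) = if i ∈ I then c else 0 := by
  change thinCoord k (i ∈ I) (thinConst k (i ∈ I) c) = _
  unfold thinCoord
  split_ifs <;> simp [thinConst]

lemma coordAt_constAt_of_mem {I : Set V} {i : V} (hi : i ∈ I) (c : k) :
    coordAt (Q := Q) I i (constAt I i c) = c := by
  rw [coordAt_constAt, if_pos hi]

lemma constAt_coordAt (I : Set V) (i : V) (x : (thinRep k Q I).space i) :
    constAt I i (coordAt I i x) = x := by
  have (p : Prop) (y : PLift p → k) : thinConst k p (thinCoord k p y) = y := by
    funext h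
    simp [thinCoord, thinConst, h.down]
  exact this _ x

lemma coordAt_injective (I : Set V) (i : V) :
    Function.Injective (coordAt (k := k) (Q := Q) I i) :=
  Function.LeftInverse.injective (constAt_coordAt I i)

lemma coordAt_of_notMem {I : Set V} {i : V} (hi : i ∉ I) (x : (thinRep k Q I).space i) :
    coordAt I i x = 0 :=
  LinearMap.congr_fun (dif_neg hi) x

open Classical in
lemma dimVec_thinRep (I : Set V) (i : V) :
    dimVec (thinRep k Q I) i = if i ∈ I then 1 else 0 := by
  change Module.finrank k (PLift (i ∈ I) → k) = _
  split_ifs with h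
  · have : Unique (PLift (i ∈ I)) := ⟨⟨⟨h⟩⟩, fun _ => Subsingleton.elim _ _⟩
    simp
  · have : IsEmpty (PLift (i ∈ I)) := ⟨fun x => h x.down⟩
    simp

lemma isFinDim_thinRep (I : Set V) : IsFinDim (thinRep k Q I) := fun i =>
  FiniteDimensional.of_injective (coordAt I i) (coordAt_injective I i)

lemma not_isZero_thinRep {I : Set V} {i : V} (hi : i ∈ I) : ¬IsZero (thinRep k Q I) := by
  intro h
  have hzero : constAt (Q := Q) I i (1 : k) = 0 := by
    rw [← QRep.homAt_id (thinRep k Q I) i (constAt I i 1), h.eq_of_src (𝟙 (thinRep k Q I)) 0,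
      QRep.homAt_zero]
  simpa [coordAt_constAt_of_mem hi] using congrArg (coordAt I i) hzero

/-- A cochain on the arrows from `I` to `J` is an extension class of thin representations; a
potential supported on `I ∩ J` trivializes it. -/
lemma subsingleton_ext_one_thinRep [HasExt.{v'} (QRep k Q)] {I J : Set V}
    (H : ∀ c : (∀ i j : V, Q.Hom i j → k), ∃ e : V → k, (∀ i, ¬(i ∈ I ∧ i ∈ J) → e i = 0) ∧
      ∀ (i j : V) (f : Q.Hom i j), i ∈ I → j ∈ J → c i j f = e i - e j) :
    Subsingleton (Abelian.Ext (thinRep k Q I) (thinRep k Q J) 1) := by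
  refine QRep.subsingleton_ext_one fun h => ?_
  obtain ⟨e, he0, he⟩ := H fun i j f => coordAt J j (h i j f (constAt I i 1))
  refine ⟨fun i => constAt J i ∘ₗ (e i • coordAt I i), fun i j f x => coordAt_injective J j ?_⟩
  by_cases hj : j ∈ J
  swap
  · rw [coordAt_of_notMem hj, coordAt_of_notMem hj]
  by_cases hi : i ∈ I
  swap
  · simp [coordAt_injective I i (show coordAt I i x = coordAt I i 0 by
      rw [coordAt_of_notMem hi, map_zero])]
  obtain ⟨y, rfl⟩ : ∃ y : k, x = y • constAt I i 1 :=
    ⟨coordAt I i x, by rw [← map_smul, smul_eq_mul, mul_one, constAt_coordAt]⟩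
  simp only [map_smul, LinearMap.comp_apply, LinearMap.smul_apply, smul_eq_mul,
    map_sub, thinRep_arrowMap, coordAt_constAt, hi, hj, if_true, he i j f hi hj]
  split_ifs <;> simp_all [mul_sub]

end ThinRepresentations

section Indecomposables

lemma indecomposable_of_idempotents {C : Type*} [Category C] [Preadditive C]
    [HasBinaryBiproducts C] {X : C} (hX : ¬IsZero X)
    (h : ∀ e : X ⟶ X, e ≫ e = e → e = 0 ∨ e = 𝟙 X) : Indecomposable X := by
  refine ⟨hX, fun Y Z α => ?_⟩
  rcases h (α.hom ≫ biprod.fst ≫ biprod.inl ≫ α.inv) (by simp) with he | he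
  · left
    rw [IsZero.iff_id_eq_zero]
    have : (biprod.inl : Y ⟶ Y ⊞ Z) ≫ α.inv ≫ (α.hom ≫ biprod.fst ≫ biprod.inl ≫ α.inv) ≫
        α.hom ≫ biprod.fst = 0 := by rw [he]; simp
    simpa using this
  · right
    rw [IsZero.iff_id_eq_zero]
    have : (biprod.inr : Z ⟶ Y ⊞ Z) ≫ α.inv ≫ (α.hom ≫ biprod.fst ≫ biprod.inl ≫ α.inv) ≫
        α.hom ≫ biprod.snd = 𝟙 Z := by rw [he]; simp
    simpa using this.symm

lemma exists_iso_biprod_of_retraction {C : Type*} [Category C] [Abelian C] {X Y : C}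
    (f : X ⟶ Y) (r : Y ⟶ X) (h : f ≫ r = 𝟙 X) : ∃ Z : C, Nonempty (Y ≅ X ⊞ Z) := by
  have : IsSplitMono f := ⟨⟨⟨r, h⟩⟩⟩
  exact ⟨_, ⟨biprod.uniqueUpToIso _ _
    (isBilimitBinaryBiconeOfIsSplitMonoOfCokernel (cokernelIsCokernel f))⟩⟩

lemma nonempty_iso_of_retraction {C : Type*} [Category C] [Abelian C] {X Y : C}
    (hY : Indecomposable Y) (hX : ¬IsZero X) (f : X ⟶ Y) (r : Y ⟶ X) (h : f ≫ r = 𝟙 X) :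
    Nonempty (Y ≅ X) := by
  obtain ⟨Z, ⟨e⟩⟩ := exists_iso_biprod_of_retraction f r h
  exact ⟨e ≪≫ (isoBiprodZero ((hY.2 X Z e).resolve_left hX)).symm⟩

variable {k : Type u} [Field k] {V : Type w} {Q : Quiver.{v} V}

lemma exists_scalar_of_thinRep_end {I : Set V}
    (hconn : ∀ i j : I, Relation.EqvGen (fun i j : I => Nonempty (Q.Hom i j)) i j)
    (e : thinRep k Q I ⟶ thinRep k Q I) :
    ∃ c : k, ∀ i x, coordAt I i (QRep.homAt e i x) = c * coordAt I i x := by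
  let s (i : V) : k := coordAt I i (QRep.homAt e i (constAt I i 1))
  have hs (i : V) (x : (thinRep k Q I).space i) :
      coordAt I i (QRep.homAt e i x) = s i * coordAt I i x := by
    conv_lhs => rw [← constAt_coordAt I i x, ← mul_one (coordAt I i x), ← smul_eq_mul, map_smul,
      map_smul, map_smul, smul_eq_mul, mul_comm]
  have hs_arrow (i j : I) (f : Q.Hom i j) : s i = s j := by
    have h := congrArg (coordAt I j) (QRep.homAt_arrowMap e f (constAt I i 1))
    rw [hs, thinRep_arrowMap, thinRep_arrowMap, hs, coordAt_constAt_of_mem j.2,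
      coordAt_constAt_of_mem j.2, coordAt_constAt_of_mem i.2] at h
    simpa using h.symm
  have hs_const {i j : I} (h : Relation.EqvGen (fun i j : I => Nonempty (Q.Hom i j)) i j) :
      s i = s j := by
    induction h with
    | rel i j h => exact h.elim (hs_arrow i j)
    | refl => rfl
    | symm _ _ _ ih => exact ih.symm
    | trans _ _ _ _ _ ih ih' => exact ih.trans ih'
  rcases I.eq_empty_or_nonempty with rfl | ⟨i₀, hi₀⟩
  · exact ⟨0, fun i x => by rw [coordAt_of_notMem (Set.notMem_empty i), zero_mul]⟩
  · refine ⟨s i₀, fun i x => ?_⟩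
    by_cases hi : i ∈ I
    · rw [hs, hs_const (hconn ⟨i, hi⟩ ⟨i₀, hi₀⟩)]
    · rw [coordAt_of_notMem hi, coordAt_of_notMem hi, mul_zero]

lemma indecomposable_thinRep {I : Set V} (hI : I.Nonempty)
    (hconn : ∀ i j : I, Relation.EqvGen (fun i j : I => Nonempty (Q.Hom i j)) i j) :
    Indecomposable (thinRep k Q I) := by
  obtain ⟨i₀, hi₀⟩ := hI
  refine indecomposable_of_idempotents (not_isZero_thinRep hi₀) fun e he => ?_
  obtain ⟨c, hc⟩ := exists_scalar_of_thinRep_end hconn e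
  have hidem : c * c = c := by
    simpa only [QRep.homAt_comp, hc, coordAt_constAt_of_mem hi₀, mul_one] using
      congrArg (fun φ => coordAt I i₀ (QRep.homAt φ i₀ (constAt I i₀ 1))) he
  refine (IsIdempotentElem.iff_eq_zero_or_one.1 hidem).imp (fun h => ?_) (fun h => ?_) <;>
    refine QRep.hom_ext fun i x => coordAt_injective I i ?_
  · rw [hc, h, zero_mul, QRep.homAt_zero, map_zero]
  · rw [hc, h, one_mul, QRep.homAt_id]

end Indecomposables

section LinearQuivers

/-- A quiver with vertices at distinct positions on a line, and exactly one arrow between vertices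
at consecutive positions and no other arrows. The arrow between positions `t` and `t + 1` points
upwards if and only if `o (t + 1)`. Positions without a vertex are allowed, so that full subquivers
of linear quivers are linear. -/
structure IsLinear {V : Type w} (Q : Quiver.{v} V) (pos : V → ℕ) (o : ℕ → Prop) : Prop where
  injective : Function.Injective pos
  subsingleton : ∀ i j, Subsingleton (Q.Hom i j)
  hom : ∀ {i j}, Q.Hom i j →
    (pos i + 1 = pos j ∧ o (pos j)) ∨ (pos j + 1 = pos i ∧ ¬o (pos i))
  up : ∀ {i j}, pos i + 1 = pos j → o (pos j) → Nonempty (Q.Hom i j)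
  down : ∀ {i j}, pos i + 1 = pos j → ¬o (pos j) → Nonempty (Q.Hom j i)

/-- The vertices with position in the half-open interval from `I.1` to `I.2`. -/
abbrev posIco {V : Type w} (pos : V → ℕ) (I : ℕ × ℕ) : Set V := pos ⁻¹' Set.Ico I.1 I.2

/-- Intervals with left ends `a` and `c` which overlap have no nonzero morphism of interval
modules from the first to the second, because the arrow at one of the left ends points the wrong
way. -/
def LeftBlock (o : ℕ → Prop) (a c : ℕ) : Prop := (a < c ∧ o c) ∨ (c < a ∧ ¬o a)

/-- The condition on the right ends of two half-open intervals that is dual to `LeftBlock`. -/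
def RightBlock (o : ℕ → Prop) (b d : ℕ) : Prop := (b < d ∧ o b) ∨ (d < b ∧ ¬o d)

/-- The combinatorial condition on half-open intervals for the vanishing of `Ext¹` between the
corresponding interval modules: the intervals are not adjacent, and they are not blocked at both
ends. -/
def ExtVanish (o : ℕ → Prop) (I J : ℕ × ℕ) : Prop :=
  I.2 ≠ J.1 ∧ J.2 ≠ I.1 ∧
    (I.1 < J.2 → J.1 < I.2 → ¬(LeftBlock o I.1 J.1 ∧ RightBlock o I.2 J.2))

lemma ExtVanish.exists_outer_position {o : ℕ → Prop} {I J : ℕ × ℕ} (h : ExtVanish o I J) :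
    ∃ u, ∀ s ∈ Set.Ico I.1 I.2, ∀ t ∈ Set.Ico J.1 J.2,
      (s + 1 = t ∧ o t) ∨ (t + 1 = s ∧ ¬o s) →
        (s ∈ Set.Ico J.1 J.2 ∧ t ∈ Set.Ico I.1 I.2) ∨
        (s ∈ Set.Ico J.1 J.2 ∧ t ∉ Set.Ico I.1 I.2 ∧ t = u) ∨
        (s ∉ Set.Ico J.1 J.2 ∧ t ∈ Set.Ico I.1 I.2 ∧ s = u) := by
  obtain ⟨hIJ, hJI, hblock⟩ := h
  by_cases hleft : LeftBlock o I.1 J.1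
  · refine ⟨max I.1 J.1 - 1, fun s hs t ht hst => ?_⟩
    simp only [LeftBlock, RightBlock, Set.mem_Ico] at *
    grind
  · refine ⟨min I.2 J.2, fun s hs t ht hst => ?_⟩
    simp only [LeftBlock, RightBlock, Set.mem_Ico] at *
    grind

namespace IsLinear

variable {k : Type u} [Field k] {V : Type w} {Q : Quiver.{v} V} {pos : V → ℕ} {o : ℕ → Prop}

lemma isEmpty_hom (hQ : IsLinear Q pos o) {i j : V} (f : Q.Hom i j) : IsEmpty (Q.Hom j i) :=
  ⟨fun g => by have hf := hQ.hom f; have hg := hQ.hom g; grind⟩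

lemma exists_potential {A : Type*} [AddCommGroup A] (hQ : IsLinear Q pos o)
    (c : ∀ i j : V, Q.Hom i j → A) :
    ∃ h : ℕ → A, ∀ (i j : V) (f : Q.Hom i j), c i j f = h (pos i) - h (pos j) := by
  classical
  have hunique (s t : ℕ) : ∃ y, ∀ (i j : V) (f : Q.Hom i j), pos i = s → pos j = t →
      c i j f = y := by
    by_cases hst : ∃ i j : V, Nonempty (Q.Hom i j) ∧ pos i = s ∧ pos j = t
    · obtain ⟨i, j, ⟨f⟩, rfl, rfl⟩ := hst
      refine ⟨c i j f, fun i' j' f' hi hj => ?_⟩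
      obtain rfl := hQ.injective hi
      obtain rfl := hQ.injective hj
      rw [(hQ.subsingleton _ _).elim f' f]
    · exact ⟨0, fun i j f hi hj => (hst ⟨i, j, ⟨f⟩, hi, hj⟩).elim⟩
  choose y hy using hunique
  let δ (t : ℕ) : A := if o (t + 1) then -y t (t + 1) else y (t + 1) t
  refine ⟨fun t => ∑ s ∈ Finset.range t, δ s, fun i j f => ?_⟩
  rw [hy _ _ i j f rfl rfl]
  rcases hQ.hom f with ⟨hp, ho⟩ | ⟨hp, ho⟩ <;> rw [← hp] at ho ⊢ <;>
    simp [Finset.sum_range_succ, δ, ho]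

lemma subsingleton_ext_one [HasExt.{v'} (QRep k Q)] (hQ : IsLinear Q pos o) {I J : ℕ × ℕ}
    (h : ExtVanish o I J) :
    Subsingleton (Abelian.Ext (thinRep k Q (posIco pos I)) (thinRep k Q (posIco pos J)) 1) := by
  classical
  refine subsingleton_ext_one_thinRep fun c => ?_
  obtain ⟨p, hp⟩ := hQ.exists_potential c
  obtain ⟨u, hu⟩ := h.exists_outer_position
  let e (t : ℕ) : k := if t ∈ Set.Ico I.1 I.2 ∧ t ∈ Set.Ico J.1 J.2 then p t - p u else 0
  refine ⟨fun i => e (pos i), fun i hi => if_neg hi, fun i j f hi hj => ?_⟩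
  rw [Set.mem_preimage] at hi hj
  rcases hu _ hi _ hj (hQ.hom f) with ⟨hiJ, hjI⟩ | ⟨hiJ, hjI, rfl⟩ | ⟨hiJ, hjI, rfl⟩ <;>
    simp [e, hp, hi, hj, hiJ, hjI, -Set.mem_Ico]

lemma eqvGen_posIco (hQ : IsLinear Q pos o) {I : ℕ × ℕ} (hI : Set.Ico I.1 I.2 ⊆ Set.range pos)
    (i j : posIco pos I) :
    Relation.EqvGen (fun i j : posIco pos I => Nonempty (Q.Hom i j)) i j := by
  wlog hij : pos i ≤ pos j generalizing i j
  · exact (this j i (le_of_not_ge hij)).symm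
  obtain ⟨d, hd⟩ := Nat.exists_eq_add_of_le hij
  induction d generalizing j with
  | zero => exact Subtype.ext (hQ.injective hd) ▸ .refl _
  | succ d ih =>
    obtain ⟨l, hl⟩ : pos i + d ∈ Set.range pos :=
      hI ⟨i.2.1.trans (Nat.le_add_right _ _), by have := j.2.2; omega⟩
    have hlj : pos l + 1 = pos j := by omega
    have hlI : l ∈ posIco pos I := ⟨i.2.1.trans (by omega), by have := j.2.2; omega⟩
    refine (ih ⟨l, hlI⟩ (by simp [hl]) hl).trans _ _ _ ?_
    by_cases ho : o (pos j)
    · exact .rel _ _ (hQ.up hlj ho)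
    · exact .symm _ _ (.rel _ _ (hQ.down hlj ho))

lemma indecomposable_thinRep (hQ : IsLinear Q pos o) {I : ℕ × ℕ} (hlt : I.1 < I.2)
    (hI : Set.Ico I.1 I.2 ⊆ Set.range pos) : Indecomposable (thinRep k Q (posIco pos I)) := by
  obtain ⟨i, hi⟩ := hI ⟨le_rfl, hlt⟩
  exact QuiverTilting.indecomposable_thinRep ⟨i, hi.ge, hi.trans_lt hlt⟩ (hQ.eqvGen_posIco hI)

end IsLinear

end LinearQuivers

section Gabriel

variable {k : Type u} [Field k] {n : ℕ} {Q : Quiver.{v} (Fin n)} {o : ℕ → Prop}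

/-- A family of vectors, one for each vertex, which vanishes below `a` and is compatible with the
arrows between vertices up to `m` that start at a vertex not below `a`. -/
def IsVectorStrip (N : QRep k Q) (a m : ℕ) (w : ∀ i, N.space i) : Prop :=
  (∀ i : Fin n, (i : ℕ) < a → w i = 0) ∧
    ∀ (i j : Fin n) (f : Q.Hom i j), (i : ℕ) ≤ m → (j : ℕ) ≤ m → a ≤ (i : ℕ) →
      N.arrowMap f (w i) = w j

/-- A family of linear forms, one for each vertex, which vanishes below `a` and is compatible with
the arrows between vertices up to `m` that end at a vertex not below `a`. -/
def IsCovectorStrip (N : QRep k Q) (a m : ℕ) (ζ : ∀ i, N.space i →ₗ[k] k) : Prop :=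
  (∀ i : Fin n, (i : ℕ) < a → ζ i = 0) ∧
    ∀ (i j : Fin n) (f : Q.Hom i j), (i : ℕ) ≤ m → (j : ℕ) ≤ m → a ≤ (j : ℕ) →
      ζ j ∘ₗ N.arrowMap f = ζ i

/-- Between the subspaces `A` and `B` at the vertex `m`, every vector extends to a compatible
family of vectors, and every linear form to a compatible family of linear forms, on the same
interval `[a, m]`. For a vector in `B` and a linear form that kills `A` and takes the value `1` on
it, these families split off an interval module. -/
def IsStrip (N : QRep k Q) (m : Fin n) (A B : Submodule k (N.space m)) : Prop :=
  ∃ a ≤ (m : ℕ), (∀ v ∈ B, ∃ w, w m = v ∧ IsVectorStrip N a m w) ∧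
    ∀ ξ : N.space m →ₗ[k] k, A ≤ LinearMap.ker ξ → ∃ ζ, ζ m = ξ ∧ IsCovectorStrip N a m ζ

lemma IsLinear.exists_extend_family (hQ : IsLinear Q Fin.val o) {X : Fin n → Type*}
    {R : ∀ i j, Q.Hom i j → X i → X j → Prop} {m m' : Fin n} (hm : (m : ℕ) + 1 = m')
    {x : ∀ i, X i} (hx : ∀ (i j : Fin n) f, (i : ℕ) ≤ m → (j : ℕ) ≤ m → R i j f (x i) (x j))
    {y : X m'} (hxy : ∀ f, R m m' f (x m) y) (hyx : ∀ f, R m' m f y (x m)) :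
    ∃ x' : ∀ i, X i, x' m' = y ∧ (∀ i ≠ m', x' i = x i) ∧
      ∀ (i j : Fin n) f, (i : ℕ) ≤ m' → (j : ℕ) ≤ m' → R i j f (x' i) (x' j) := by
  refine ⟨Function.update x m' y, Function.update_self _ _ _,
    fun i hi => Function.update_of_ne hi _ _, fun i j f hi hj => ?_⟩
  have hadj := hQ.hom f
  rcases eq_or_ne i m' with rfl | him
  · obtain rfl : j = m := Fin.ext (by omega)
    rw [Function.update_self, Function.update_of_ne (by rintro rfl; omega)]
    exact hyx f
  rcases eq_or_ne j m' with rfl | hjm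
  · obtain rfl : i = m := Fin.ext (by omega)
    rw [Function.update_self, Function.update_of_ne him]
    exact hxy f
  · rw [Function.update_of_ne him, Function.update_of_ne hjm]
    exact hx i j f (by omega) (by omega)

lemma IsVectorStrip.exists_extend (hQ : IsLinear Q Fin.val o) {N : QRep k Q} {a : ℕ}
    {m m' : Fin n} (hm : (m : ℕ) + 1 = m') {w : ∀ i, N.space i} (hw : IsVectorStrip N a m w)
    (ha : a ≤ (m' : ℕ)) {v : N.space m'}
    (hup : ∀ f : Q.Hom m m', a ≤ (m : ℕ) → N.arrowMap f (w m) = v)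
    (hdown : ∀ f : Q.Hom m' m, N.arrowMap f v = w m) :
    ∃ w', w' m' = v ∧ IsVectorStrip N a m' w' := by
  obtain ⟨w', hv, heq, hw'⟩ := hQ.exists_extend_family
    (R := fun i _ f x y => a ≤ (i : ℕ) → N.arrowMap f x = y) hm hw.2 hup fun f _ => hdown f
  exact ⟨w', hv, fun i hi => (heq i (by rintro rfl; omega)).trans (hw.1 i hi), hw'⟩

lemma IsCovectorStrip.exists_extend (hQ : IsLinear Q Fin.val o) {N : QRep k Q} {a : ℕ}
    {m m' : Fin n} (hm : (m : ℕ) + 1 = m') {ζ : ∀ i, N.space i →ₗ[k] k}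
    (hζ : IsCovectorStrip N a m ζ) (ha : a ≤ (m' : ℕ)) {ξ : N.space m' →ₗ[k] k}
    (hup : ∀ f : Q.Hom m m', ξ ∘ₗ N.arrowMap f = ζ m)
    (hdown : ∀ f : Q.Hom m' m, a ≤ (m : ℕ) → ζ m ∘ₗ N.arrowMap f = ξ) :
    ∃ ζ', ζ' m' = ξ ∧ IsCovectorStrip N a m' ζ' := by
  obtain ⟨ζ', hξ, heq, hζ'⟩ := hQ.exists_extend_family (X := fun i => N.space i →ₗ[k] k)
    (R := fun _ j f x y => a ≤ (j : ℕ) → y ∘ₗ N.arrowMap f = x) hm hζ.2 (fun f _ => hup f) hdown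
  exact ⟨ζ', hξ, fun i hi => (heq i (by rintro rfl; omega)).trans (hζ.1 i hi), hζ'⟩

lemma isVectorStrip_zero (N : QRep k Q) (a m : ℕ) : IsVectorStrip N a m fun _ => 0 :=
  ⟨fun _ _ => rfl, fun _ _ _ _ _ _ => map_zero _⟩

lemma isCovectorStrip_zero (N : QRep k Q) (a m : ℕ) : IsCovectorStrip N a m fun _ => 0 :=
  ⟨fun _ _ => rfl, fun _ _ _ _ _ _ => LinearMap.zero_comp _⟩

lemma IsStrip.map (hQ : IsLinear Q Fin.val o) {N : QRep k Q} {m m' : Fin n}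
    (hm : (m : ℕ) + 1 = m') (f : Q.Hom m m') {A B : Submodule k (N.space m)}
    (h : IsStrip N m A B) : IsStrip N m' (A.map (N.arrowMap f)) (B.map (N.arrowMap f)) := by
  have := hQ.isEmpty_hom f
  have := hQ.subsingleton m m'
  obtain ⟨a, ha, hB, hA⟩ := h
  refine ⟨a, by omega, ?_, fun ξ hξ => ?_⟩
  · rintro _ ⟨v, hv, rfl⟩
    obtain ⟨w, rfl, hw⟩ := hB v hv
    exact hw.exists_extend hQ hm (by omega) (fun g _ => by rw [Subsingleton.elim g f]) isEmptyElim
  · obtain ⟨ζ, hζm, hζ⟩ := hA (ξ ∘ₗ N.arrowMap f)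
      (by rwa [LinearMap.ker_comp, ← Submodule.map_le_iff_le_comap])
    exact hζ.exists_extend hQ hm (by omega) (fun g => by rw [Subsingleton.elim g f, hζm])
      isEmptyElim

lemma IsStrip.comap (hQ : IsLinear Q Fin.val o) {N : QRep k Q} {m m' : Fin n}
    (hm : (m : ℕ) + 1 = m') (f : Q.Hom m' m) {A B : Submodule k (N.space m)}
    (h : IsStrip N m A B) : IsStrip N m' (A.comap (N.arrowMap f)) (B.comap (N.arrowMap f)) := by
  have := hQ.isEmpty_hom f
  have := hQ.subsingleton m' m
  obtain ⟨a, ha, hB, hA⟩ := h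
  refine ⟨a, by omega, fun v hv => ?_, fun ξ hξ => ?_⟩
  · obtain ⟨w, hwm, hw⟩ := hB _ hv
    exact hw.exists_extend hQ hm (by omega) isEmptyElim
      fun g => by rw [Subsingleton.elim g f, hwm]
  · obtain ⟨ξ', rfl⟩ : ξ ∈ LinearMap.range (A.mkQ ∘ₗ N.arrowMap f).dualMap := by
      rw [LinearMap.range_dualMap_eq_dualAnnihilator_ker, Submodule.mem_dualAnnihilator]
      exact fun x hx => hξ (by simpa using hx)
    obtain ⟨ζ, hζm, hζ⟩ := hA (ξ' ∘ₗ A.mkQ) fun x hx => by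
      rw [LinearMap.mem_ker, LinearMap.comp_apply, Submodule.mkQ_apply,
        (Submodule.Quotient.mk_eq_zero A).2 hx, map_zero]
    refine hζ.exists_extend hQ hm (by omega) isEmptyElim fun g _ => ?_
    rw [Subsingleton.elim g f, hζm]
    rfl

lemma isStrip_range_top (hQ : IsLinear Q Fin.val o) (N : QRep k Q) {m m' : Fin n}
    (hm : (m : ℕ) + 1 = m') (f : Q.Hom m m') :
    IsStrip N m' (LinearMap.range (N.arrowMap f)) ⊤ := by
  have := hQ.isEmpty_hom f
  have := hQ.subsingleton m m'
  refine ⟨m', le_rfl, fun v _ => ?_, fun ξ hξ => ?_⟩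
  · exact (isVectorStrip_zero N m' m).exists_extend hQ hm le_rfl (fun _ h => by omega) isEmptyElim
  · refine (isCovectorStrip_zero N m' m).exists_extend hQ hm le_rfl (fun g => ?_) isEmptyElim
    rw [Subsingleton.elim g f, ← LinearMap.range_le_ker_iff]
    exact hξ

lemma isStrip_bot_ker (hQ : IsLinear Q Fin.val o) (N : QRep k Q) {m m' : Fin n}
    (hm : (m : ℕ) + 1 = m') (f : Q.Hom m' m) :
    IsStrip N m' ⊥ (LinearMap.ker (N.arrowMap f)) := by
  have := hQ.isEmpty_hom f
  have := hQ.subsingleton m' m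
  refine ⟨m', le_rfl, fun v hv => ?_, fun ξ _ => ?_⟩
  · refine (isVectorStrip_zero N m' m).exists_extend hQ hm le_rfl isEmptyElim fun g => ?_
    rw [Subsingleton.elim g f]
    exact hv
  · exact (isCovectorStrip_zero N m' m).exists_extend hQ hm le_rfl isEmptyElim
      fun _ h => by omega

lemma isStrip_bot_top_zero (hQ : IsLinear Q Fin.val o) (N : QRep k Q) (h0 : 0 < n) :
    IsStrip N ⟨0, h0⟩ ⊥ ⊤ := by
  have hno (i j : Fin n) (f : Q.Hom i j) (hi : (i : ℕ) ≤ 0) (hj : (j : ℕ) ≤ 0) : False := by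
    have := hQ.hom f
    omega
  exact ⟨0, le_rfl,
    fun v _ => ⟨Function.update (fun _ => 0) _ v, Function.update_self _ _ _,
      fun _ hi => absurd hi (Nat.not_lt_zero _), fun i j f hi hj => (hno i j f hi hj).elim⟩,
    fun ξ _ => ⟨Function.update (fun _ => 0) _ ξ, Function.update_self _ _ _,
      fun _ hi => absurd hi (Nat.not_lt_zero _), fun i j f hi hj => (hno i j f hi hj).elim⟩⟩

lemma reflTransGen_isStrip (hQ : IsLinear Q Fin.val o) (N : QRep k Q) (m : Fin n) :
    Relation.ReflTransGen (IsStrip N m) ⊥ ⊤ := by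
  obtain ⟨t, ht⟩ := m
  induction t with
  | zero => exact .single (isStrip_bot_top_zero hQ N ht)
  | succ t ih =>
    have hm : ((⟨t, by omega⟩ : Fin n) : ℕ) + 1 = (⟨t + 1, ht⟩ : Fin n) := rfl
    by_cases ho : o (t + 1)
    · obtain ⟨f⟩ := hQ.up hm ho
      have h := (ih (by omega)).lift (Submodule.map (N.arrowMap f)) fun _ _ => IsStrip.map hQ hm f
      rw [Function.onFun, Submodule.map_bot, Submodule.map_top] at h
      exact h.tail (isStrip_range_top hQ N hm f)
    · obtain ⟨f⟩ := hQ.down hm ho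
      have h := (ih (by omega)).lift (Submodule.comap (N.arrowMap f))
        fun _ _ => IsStrip.comap hQ hm f
      rw [Function.onFun, Submodule.comap_bot, Submodule.comap_top] at h
      exact h.head (isStrip_bot_ker hQ N hm f)

lemma exists_isStrip_not_le (hQ : IsLinear Q Fin.val o) (N : QRep k Q) (m : Fin n)
    [Nontrivial (N.space m)] : ∃ A B, IsStrip N m A B ∧ ¬B ≤ A := by
  by_contra! h
  have hle : ∀ B, Relation.ReflTransGen (IsStrip N m) ⊥ B → B ≤ ⊥ := by
    intro B hB
    induction hB with
    | refl => exact le_rfl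
    | tail _ h' ih => exact (h _ _ h').trans ih
  exact bot_ne_top (le_bot_iff.1 (hle _ (reflTransGen_isStrip hQ N m))).symm

/-- The morphism from an interval module given by a compatible family of vectors. -/
def IsVectorStrip.hom {N : QRep k Q} {a : ℕ} {m : Fin n} {w : ∀ i, N.space i}
    (hw : IsVectorStrip N a m w) (hN : ∀ i, m < i → Subsingleton (N.space i)) :
    thinRep k Q (posIco Fin.val (a, (m : ℕ) + 1)) ⟶ N :=
  QRep.mkHom (fun i => (coordAt _ i).smulRight (w i)) fun i j f x => by
    rw [LinearMap.smulRight_apply, LinearMap.smulRight_apply, map_smul, thinRep_arrowMap]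
    rcases lt_or_ge m j with hj | hj
    · exact (hN j hj).elim _ _
    by_cases hi : i ∈ posIco Fin.val (a, (m : ℕ) + 1)
    · rw [hw.2 i j f (Nat.lt_succ_iff.1 hi.2) hj hi.1]
      rcases lt_or_ge (j : ℕ) a with hja | hja
      · rw [hw.1 j hja, smul_zero, smul_zero]
      · have hjI : j ∈ posIco Fin.val (a, (m : ℕ) + 1) := ⟨hja, Nat.lt_succ_iff.2 hj⟩
        rw [coordAt_constAt_of_mem hjI]
    · rw [coordAt_of_notMem hi, map_zero, map_zero, zero_smul, zero_smul]

/-- The morphism to an interval module given by a compatible family of linear forms. -/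
def IsCovectorStrip.hom {N : QRep k Q} {a : ℕ} {m : Fin n} {ζ : ∀ i, N.space i →ₗ[k] k}
    (hζ : IsCovectorStrip N a m ζ) (hN : ∀ i, m < i → Subsingleton (N.space i)) :
    N ⟶ thinRep k Q (posIco Fin.val (a, (m : ℕ) + 1)) :=
  QRep.mkHom (fun i => constAt _ i ∘ₗ ζ i) fun i j f x => by
    apply coordAt_injective
    rw [thinRep_arrowMap, LinearMap.comp_apply, LinearMap.comp_apply]
    by_cases hj : j ∈ posIco Fin.val (a, (m : ℕ) + 1)
    swap
    · rw [coordAt_of_notMem hj, coordAt_of_notMem hj]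
    rw [coordAt_constAt_of_mem hj, coordAt_constAt_of_mem hj]
    rcases lt_or_ge m i with hi | hi
    · have := hN i hi
      rw [Subsingleton.elim x 0]
      simp
    have hζij : ζ j (N.arrowMap f x) = ζ i x :=
      LinearMap.congr_fun (hζ.2 i j f hi (Nat.lt_succ_iff.1 hj.2) hj.1) x
    rw [hζij]
    rcases lt_or_ge (i : ℕ) a with hia | hia
    · rw [hζ.1 i hia, LinearMap.zero_apply, map_zero, map_zero]
    · have hiI : i ∈ posIco Fin.val (a, (m : ℕ) + 1) := ⟨hia, Nat.lt_succ_iff.2 hi⟩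
      rw [coordAt_constAt_of_mem hiI]

lemma IsVectorStrip.hom_comp_hom (hQ : IsLinear Q Fin.val o) {N : QRep k Q} {a : ℕ} {m : Fin n}
    (ha : a ≤ (m : ℕ)) {w : ∀ i, N.space i} (hw : IsVectorStrip N a m w)
    {ζ : ∀ i, N.space i →ₗ[k] k} (hζ : IsCovectorStrip N a m ζ)
    (hN : ∀ i, m < i → Subsingleton (N.space i)) (h : ζ m (w m) = 1) :
    hw.hom hN ≫ hζ.hom hN = 𝟙 _ := by
  have hm : m ∈ posIco Fin.val (a, (m : ℕ) + 1) := ⟨ha, Nat.lt_succ_self _⟩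
  obtain ⟨c, hc⟩ := exists_scalar_of_thinRep_end
    (hQ.eqvGen_posIco (I := (a, m + 1)) fun t ht => ⟨⟨t, ht.2.trans_le m.2⟩, rfl⟩)
    (hw.hom hN ≫ hζ.hom hN)
  have hc1 : c = 1 := by
    simpa [IsVectorStrip.hom, IsCovectorStrip.hom, coordAt_constAt_of_mem hm, h] using
      (hc m (constAt _ m 1)).symm
  refine QRep.hom_ext fun i x => coordAt_injective _ _ ?_
  rw [hc, hc1, one_mul, QRep.homAt_id]

/-- Gabriel's theorem in type `A`. -/
lemma exists_iso_thinRep (hQ : IsLinear Q Fin.val o) {N : QRep k Q} (hN : Indecomposable N) :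
    ∃ (a : ℕ) (m : Fin n), a ≤ (m : ℕ) ∧
      Nonempty (N ≅ thinRep k Q (posIco Fin.val (a, (m : ℕ) + 1))) := by
  have hne : ∃ i, Nontrivial (N.space i) := by
    by_contra! h
    exact hN.1 ((IsZero.iff_id_eq_zero N).2 (QRep.hom_ext fun i x => (h i).elim _ _))
  obtain ⟨m, hm, hmax⟩ := (Set.toFinite {i | Nontrivial (N.space i)}).exists_maximal hne
  have hzero (i : Fin n) (hi : m < i) : Subsingleton (N.space i) :=
    not_nontrivial_iff_subsingleton.1 fun h => hi.not_ge (hmax h hi.le)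
  have : Nontrivial (N.space m) := hm
  obtain ⟨A, B, ⟨a, ha, hB, hA⟩, hAB⟩ := exists_isStrip_not_le hQ N m
  obtain ⟨v, hvB, hvA⟩ := Set.not_subset.1 hAB
  obtain ⟨ξ, hξv, hξA⟩ := Submodule.exists_le_ker_of_notMem hvA
  obtain ⟨w, rfl, hw⟩ := hB v hvB
  obtain ⟨ζ, hζm, hζ⟩ := hA ((ξ (w m))⁻¹ • ξ) fun x hx => by
    simp [LinearMap.mem_ker.1 (hξA hx)]
  exact ⟨a, m, ha, nonempty_iso_of_retraction hN (not_isZero_thinRep ⟨ha, Nat.lt_succ_self _⟩) _ _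
    (hw.hom_comp_hom hQ ha hζ hzero (by simp [hζm, hξv]))⟩

end Gabriel

section TiltingFamilies

variable {o : ℕ → Prop} {S : Set ℕ} {n : ℕ} {F : Finset (ℕ × ℕ)} {L : Finset ℕ} {s : ℕ}

open Classical in
/-- A rank on left ends for which `LeftBlock` is the strict order. -/
def leftRank (o : ℕ → Prop) (a : ℕ) : ℤ := if o a then a else -a

lemma leftBlock_iff_leftRank_lt {a c : ℕ} : LeftBlock o a c ↔ leftRank o a < leftRank o c := by
  unfold LeftBlock leftRank
  split_ifs <;> grind

lemma extVanish_of_lt {a c b : ℕ} (ha : a < b) (hc : c < b) : ExtVanish o (a, b) (c, b) := by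
  simp only [ExtVanish, RightBlock]
  grind

/-- A family of half-open intervals in `S ∩ [0, n)` without extensions between them, which covers
`S ∩ [0, n)` and has as many members as this set. -/
structure IsTiltingFamily (o : ℕ → Prop) (S : Set ℕ) (n : ℕ) (F : Finset (ℕ × ℕ)) : Prop where
  lt : ∀ I ∈ F, I.1 < I.2
  le : ∀ I ∈ F, I.2 ≤ n
  subset : ∀ I ∈ F, Set.Ico I.1 I.2 ⊆ S
  extVanish : ∀ I ∈ F, ∀ J ∈ F, ExtVanish o I J
  card : F.card = (S ∩ Set.Iio n).ncard
  cover : ∀ t < n, t ∈ S → ∃ I ∈ F, t ∈ Set.Ico I.1 I.2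

/-- The left ends of the intervals of a family which end at `n`. -/
def lastStarts (F : Finset (ℕ × ℕ)) (n : ℕ) : Finset ℕ := (F.filter fun I => I.2 = n).image Prod.fst

lemma mem_lastStarts {a : ℕ} : a ∈ lastStarts F n ↔ (a, n) ∈ F := by
  simp [lastStarts]

/-- Adding the position `n` to a family: the intervals `[a, n)` with `a ∈ L` are replaced by
`[a, n + 1)`, and the interval `[s, n + 1)` is added. -/
def extendFamily (F : Finset (ℕ × ℕ)) (n : ℕ) (L : Finset ℕ) (s : ℕ) : Finset (ℕ × ℕ) :=
  (F \ L.image fun a => (a, n)) ∪ (insert s L).image fun a => (a, n + 1)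

/-- The choices of `L` and `s` for which `extendFamily F n L s` is again without extensions: the
left ends in `L` and `s` come first in the order on left ends which the arrow below `n` dictates,
where `s = n` stands for the interval `[n, n + 1)` when nothing else is left. -/
structure IsCut (o : ℕ → Prop) (F : Finset (ℕ × ℕ)) (n : ℕ) (L : Finset ℕ) (s : ℕ) : Prop where
  subset : L ⊆ lastStarts F n
  notMem : s ∉ L
  mem_or : s ∈ lastStarts F n ∨ (s = n ∧ L = lastStarts F n)
  not_leftBlock : ∀ a ∈ insert s L, ∀ c ∈ lastStarts F n, c ∉ L →
    (o n → ¬LeftBlock o c a) ∧ (¬o n → ¬LeftBlock o a c)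

lemma exists_sum_le_threshold {ι R : Type*} [LinearOrder R] (A : Finset ι) (μ : ι → R) (c : ι → ℝ)
    {y : ℝ} (hy : 0 ≤ y) :
    ∃ L ⊆ A, ∑ a ∈ L, c a ≤ y ∧ (∀ b ∈ L, ∀ a ∈ A, a ∉ L → μ b ≤ μ a) ∧
      (L = A ∨ ∃ s ∈ A, s ∉ L ∧ y ≤ ∑ a ∈ L, c a + c s ∧ ∀ a ∈ A, a ∉ L → μ s ≤ μ a) := by
  classical
  induction A using Finset.induction_on_max_value μ with
  | empty => exact ⟨∅, subset_rfl, by simpa, by simp, .inl rfl⟩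
  | insert a A haA hmax ih =>
    obtain ⟨L, hLA, hle, hL, rfl | ⟨s, hsA, hsL, hys, hs⟩⟩ := ih
    · rcases le_total y (∑ b ∈ L, c b + c a) with hya | hya
      · refine ⟨L, Finset.subset_insert _ _, hle, fun b hb b' hb' hbL => ?_,
          .inr ⟨a, Finset.mem_insert_self _ _, haA, hya, fun b' hb' hbL => ?_⟩⟩ <;>
        obtain rfl := (Finset.mem_insert.1 hb').resolve_right hbL
        exacts [hmax b hb, le_rfl]
      · exact ⟨insert a L, subset_rfl, by rwa [Finset.sum_insert haA, add_comm],
          fun _ _ b hb hbL => (hbL hb).elim, .inl rfl⟩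
    · refine ⟨L, hLA.trans (Finset.subset_insert _ _), hle, fun b hb b' hb' hbL => ?_,
        .inr ⟨s, Finset.mem_insert_of_mem hsA, hsL, hys, fun b' hb' hbL => ?_⟩⟩ <;>
      rcases Finset.mem_insert.1 hb' with rfl | hb'
      exacts [hmax b (hLA hb), hL b hb b' hb' hbL, hmax s hsA, hs b' hb' hbL]

lemma exists_isCut (o : ℕ → Prop) (hn : n ∉ lastStarts F n) (c : ℕ → ℝ) {y : ℝ} (hy : 0 ≤ y) :
    ∃ L s, IsCut o F n L s ∧ ∑ a ∈ L, c a ≤ y ∧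
      (s ∈ lastStarts F n → y ≤ ∑ a ∈ L, c a + c s) := by
  classical
  let μ (a : ℕ) : ℤ := if o n then leftRank o a else -leftRank o a
  have hμ {a b : ℕ} (h : μ a ≤ μ b) :
      (o n → ¬LeftBlock o b a) ∧ (¬o n → ¬LeftBlock o a b) := by
    simp only [leftBlock_iff_leftRank_lt, not_lt]
    refine ⟨fun ho => ?_, fun ho => ?_⟩ <;> simpa [μ, ho] using h
  obtain ⟨L, hLA, hle, hL, rfl | ⟨s, hsA, hsL, hys, hs⟩⟩ :=
    exists_sum_le_threshold (lastStarts F n) μ c hy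
  · exact ⟨_, n, ⟨subset_rfl, hn, .inr ⟨rfl, rfl⟩, fun _ _ c hc hcL => (hcL hc).elim⟩, hle,
      fun h => (hn h).elim⟩
  · refine ⟨L, s, ⟨hLA, hsL, .inl hsA, fun a ha c hc hcL => hμ ?_⟩, hle, fun _ => hys⟩
    rcases Finset.mem_insert.1 ha with rfl | ha
    exacts [hs c hc hcL, hL a ha c hc hcL]

lemma IsTiltingFamily.notMem_lastStarts (hF : IsTiltingFamily o S n F) : n ∉ lastStarts F n :=
  fun h => (hF.lt _ (mem_lastStarts.1 h)).false

namespace IsCut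

lemma mem_or_eq (hcut : IsCut o F n L s) {a : ℕ} (ha : a ∈ insert s L) :
    (a, n) ∈ F ∨ a = n ∧ L = lastStarts F n := by
  rcases Finset.mem_insert.1 ha with rfl | ha
  · exact hcut.mem_or.imp_left mem_lastStarts.1
  · exact .inl (mem_lastStarts.1 (hcut.subset ha))

lemma le (hcut : IsCut o F n L s) (hF : IsTiltingFamily o S n F) {a : ℕ} (ha : a ∈ insert s L) :
    a ≤ n := by
  rcases hcut.mem_or_eq ha with h | ⟨rfl, -⟩
  exacts [(hF.lt _ h).le, le_rfl]

lemma extVanish_kept_new (hcut : IsCut o F n L s) (hF : IsTiltingFamily o S n F) {I : ℕ × ℕ}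
    (hI : I ∈ F) (hIL : I.2 = n → I.1 ∉ L) {a : ℕ} (ha : a ∈ insert s L) :
    ExtVanish o I (a, n + 1) ∧ ExtVanish o (a, n + 1) I := by
  obtain ⟨c, d⟩ := I
  have hlt := hF.lt _ hI
  have hle := hF.le _ hI
  have hmem := hcut.mem_or_eq ha
  rcases eq_or_ne d n with rfl | hd
  · have hc := mem_lastStarts.2 hI
    have haF : (a, d) ∈ F := hmem.resolve_right fun h => hIL rfl (h.2 ▸ hc)
    have hblock := hcut.not_leftBlock a ha c hc (hIL rfl)
    have had := hF.lt _ haF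
    simp only [ExtVanish, RightBlock] at *
    grind
  · rcases hmem with haF | ⟨rfl, -⟩
    · have h1 := hF.extVanish _ hI _ haF
      have h2 := hF.extVanish _ haF _ hI
      simp only [ExtVanish, RightBlock] at *
      grind
    · simp only [ExtVanish] at *
      grind

end IsCut

lemma mem_extendFamily {I : ℕ × ℕ} : I ∈ extendFamily F n L s ↔
    (I ∈ F ∧ (I.2 = n → I.1 ∉ L)) ∨ (I.2 = n + 1 ∧ I.1 ∈ insert s L) := by
  obtain ⟨c, d⟩ := I
  simp only [extendFamily, Finset.mem_union, Finset.mem_sdiff, Finset.mem_image, Prod.mk.injEq]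
  grind

lemma IsCut.card_extendFamily (hcut : IsCut o F n L s) (hF : IsTiltingFamily o S n F) :
    (extendFamily F n L s).card = F.card + 1 := by
  have hinj (m : ℕ) : Function.Injective fun a : ℕ => (a, m) := fun _ _ h => congrArg Prod.fst h
  have hLF : (L.image fun a => (a, n)) ⊆ F := Finset.image_subset_iff.2 fun a ha =>
    mem_lastStarts.1 (hcut.subset ha)
  have hdisj : Disjoint (F \ L.image fun a => (a, n)) ((insert s L).image fun a => (a, n + 1)) := by
    refine Finset.disjoint_left.2 fun I hI hI' => ?_
    obtain ⟨a, -, rfl⟩ := Finset.mem_image.1 hI'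
    exact (hF.le _ (Finset.mem_sdiff.1 hI).1).not_gt (Nat.lt_succ_self n)
  have hle := Finset.card_le_card hLF
  rw [Finset.card_image_of_injective _ (hinj n)] at hle
  rw [extendFamily, Finset.card_union_of_disjoint hdisj, Finset.card_sdiff_of_subset hLF,
    Finset.card_image_of_injective _ (hinj n), Finset.card_image_of_injective _ (hinj (n + 1)),
    Finset.card_insert_of_notMem hcut.notMem]
  omega

lemma inter_Iio_succ_of_mem (hn : n ∈ S) : S ∩ Set.Iio (n + 1) = insert n (S ∩ Set.Iio n) := by
  rw [← Order.succ_eq_add_one, Order.Iio_succ_eq_insert, Set.inter_insert_of_mem hn]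

lemma inter_Iio_succ_of_notMem (hn : n ∉ S) : S ∩ Set.Iio (n + 1) = S ∩ Set.Iio n := by
  rw [← Order.succ_eq_add_one, Order.Iio_succ_eq_insert, Set.inter_insert_of_notMem hn]

lemma IsTiltingFamily.succ_of_notMem (hF : IsTiltingFamily o S n F) (hn : n ∉ S) :
    IsTiltingFamily o S (n + 1) F where
  __ := hF
  le I hI := (hF.le I hI).trans (Nat.le_succ n)
  card := by rw [hF.card, inter_Iio_succ_of_notMem hn]
  cover t ht htS := hF.cover t
    ((Nat.lt_succ_iff.1 ht).lt_of_ne (by rintro rfl; exact hn htS)) htS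

lemma IsCut.exists_mem_extendFamily (hcut : IsCut o F n L s) (hF : IsTiltingFamily o S n F) {t : ℕ}
    (ht : t < n + 1) (htS : t ∈ S) : ∃ I ∈ extendFamily F n L s, t ∈ Set.Ico I.1 I.2 := by
  have hs : s ∈ insert s L := Finset.mem_insert_self s L
  rcases (Nat.lt_succ_iff.1 ht).eq_or_lt with rfl | htn
  · exact ⟨(s, t + 1), mem_extendFamily.2 (.inr ⟨rfl, hs⟩), hcut.le hF hs, Nat.lt_succ_self t⟩
  obtain ⟨⟨a, b⟩, hI, hat, htb⟩ := hF.cover t htn htS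
  by_cases h : b = n → a ∉ L
  · exact ⟨_, mem_extendFamily.2 (.inl ⟨hI, h⟩), hat, htb⟩
  · push Not at h
    obtain ⟨rfl, haL⟩ := h
    exact ⟨(a, b + 1), mem_extendFamily.2 (.inr ⟨rfl, Finset.mem_insert_of_mem haL⟩), hat, ht⟩

lemma IsCut.isTiltingFamily (hcut : IsCut o F n L s) (hF : IsTiltingFamily o S n F) (hn : n ∈ S) :
    IsTiltingFamily o S (n + 1) (extendFamily F n L s) where
  lt := by
    rintro ⟨a, b⟩ hI
    rcases mem_extendFamily.1 hI with ⟨hI, -⟩ | ⟨rfl, ha⟩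
    exacts [hF.lt _ hI, Nat.lt_succ_of_le (hcut.le hF ha)]
  le := by
    rintro ⟨a, b⟩ hI
    rcases mem_extendFamily.1 hI with ⟨hI, -⟩ | ⟨rfl, -⟩
    exacts [(hF.le _ hI).trans (Nat.le_succ n), le_rfl]
  subset := by
    rintro ⟨a, b⟩ hI t ht
    rcases mem_extendFamily.1 hI with ⟨hI, -⟩ | ⟨rfl, ha⟩
    · exact hF.subset _ hI ht
    rcases (Nat.lt_succ_iff.1 ht.2).eq_or_lt with rfl | htn
    · exact hn
    rcases hcut.mem_or_eq ha with haF | ⟨han, -⟩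
    exacts [hF.subset _ haF ⟨ht.1, htn⟩, (ht.1.not_gt (htn.trans_eq han.symm)).elim]
  extVanish := by
    rintro ⟨a, b⟩ hI ⟨c, d⟩ hJ
    rcases mem_extendFamily.1 hI with ⟨hI, hIL⟩ | ⟨rfl, ha⟩ <;>
      rcases mem_extendFamily.1 hJ with ⟨hJ, hJL⟩ | ⟨rfl, hc⟩
    exacts [hF.extVanish _ hI _ hJ, (hcut.extVanish_kept_new hF hI hIL hc).1,
      (hcut.extVanish_kept_new hF hJ hJL ha).2, extVanish_of_lt
        (Nat.lt_succ_of_le (hcut.le hF ha)) (Nat.lt_succ_of_le (hcut.le hF hc))]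
  card := by
    rw [hcut.card_extendFamily hF, hF.card, inter_Iio_succ_of_mem hn,
      Set.ncard_insert_of_notMem (by simp) ((Set.finite_Iio n).subset Set.inter_subset_right)]
  cover _ := hcut.exists_mem_extendFamily hF

/-- The vector with entries `1` on a half-open interval and `0` elsewhere. -/
def intervalVec (I : ℕ × ℕ) : ℕ → ℝ := Set.indicator (Set.Ico I.1 I.2) 1

lemma intervalVec_self (a : ℕ) : intervalVec (a, a) = 0 := by
  rw [intervalVec, Set.Ico_self, Set.indicator_empty']

lemma intervalVec_self_succ (a : ℕ) : intervalVec (a, a + 1) = Pi.single a 1 := by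
  rw [intervalVec, Set.Ico_add_one_right_eq_Icc, Set.Icc_self, Set.indicator_singleton,
    Pi.one_apply]

lemma intervalVec_succ {a n : ℕ} (h : a ≤ n) :
    intervalVec (a, n + 1) = intervalVec (a, n) + intervalVec (n, n + 1) := by
  rw [intervalVec, ← Set.Ico_union_Ico_eq_Ico h n.le_succ,
    Set.indicator_union_of_disjoint (Set.Ico_disjoint_Ico_same)]
  rfl

/-- For `a ∈ L`, the multiple of `[a, n + 1)` overshoots that of `[a, n)` by the same multiple of
`[n, n + 1)`; the remaining multiple of `[n, n + 1)` is absorbed by trading a part of `[s, n)` for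
`[s, n + 1)`. -/
lemma IsCut.sum_add_smul_eq (hcut : IsCut o F n L s) (hF : IsTiltingFamily o S n F)
    (c : ℕ × ℕ → ℝ) (r : ℝ) :
    ∑ I ∈ F, c I • intervalVec I + (∑ a ∈ L, c (a, n) + r) • intervalVec (n, n + 1) =
      (∑ I ∈ F \ L.image fun a => (a, n), c I • intervalVec I - r • intervalVec (s, n)) +
        ∑ a ∈ L, c (a, n) • intervalVec (a, n + 1) + r • intervalVec (s, n + 1) := by
  have hLF : (L.image fun a => (a, n)) ⊆ F := Finset.image_subset_iff.2 fun a ha =>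
    mem_lastStarts.1 (hcut.subset ha)
  have hL : ∑ a ∈ L, c (a, n) • intervalVec (a, n + 1) =
      ∑ a ∈ L, c (a, n) • intervalVec (a, n) +
        (∑ a ∈ L, c (a, n)) • intervalVec (n, n + 1) := by
    rw [Finset.sum_smul, ← Finset.sum_add_distrib]
    refine Finset.sum_congr rfl fun a ha => ?_
    rw [intervalVec_succ (hcut.le hF (Finset.mem_insert_of_mem ha)), smul_add]
  rw [← Finset.sum_sdiff hLF, Finset.sum_image (by simp), hL,
    intervalVec_succ (hcut.le hF (Finset.mem_insert_self s L))]
  module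

lemma IsCut.sum_add_smul_mem_hull (hcut : IsCut o F n L s) (hF : IsTiltingFamily o S n F)
    {c : ℕ × ℕ → ℝ} (hc : ∀ I, 0 ≤ c I) {y : ℝ} (hle : ∑ a ∈ L, c (a, n) ≤ y)
    (hge : s ∈ lastStarts F n → y ≤ ∑ a ∈ L, c (a, n) + c (s, n)) :
    ∑ I ∈ F, c I • intervalVec I + y • intervalVec (n, n + 1) ∈
      PointedCone.hull ℝ (intervalVec '' extendFamily F n L s) := by
  obtain ⟨r, rfl⟩ : ∃ r, y = ∑ a ∈ L, c (a, n) + r := ⟨_, (add_sub_cancel _ y).symm⟩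
  set K := PointedCone.hull ℝ (intervalVec '' extendFamily F n L s)
  let G := F \ L.image fun a => (a, n)
  have mem_K {I : ℕ × ℕ} (hI : I ∈ extendFamily F n L s) {r : ℝ} (hr : 0 ≤ r) :
      r • intervalVec I ∈ K :=
    PointedCone.smul_mem K hr (PointedCone.subset_hull (Set.mem_image_of_mem _ hI))
  have hkept {I : ℕ × ℕ} (hI : I ∈ G) : I ∈ extendFamily F n L s := Finset.mem_union_left _ hI
  have hnew {a : ℕ} (ha : a ∈ insert s L) : (a, n + 1) ∈ extendFamily F n L s :=
    mem_extendFamily.2 (.inr ⟨rfl, ha⟩)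
  have htrade : ∑ I ∈ G, c I • intervalVec I - r • intervalVec (s, n) ∈ K := by
    rcases hcut.mem_or with hsF | ⟨rfl, -⟩
    · have hsG : (s, n) ∈ G := by
        simp [G, mem_lastStarts.1 hsF, hcut.notMem]
      rw [← Finset.sum_erase_add _ _ hsG, add_sub_assoc, ← sub_smul]
      exact add_mem (sum_mem fun I hI => mem_K (hkept (Finset.mem_of_mem_erase hI)) (hc I))
        (mem_K (hkept hsG) (by linarith [hge hsF]))
    · rw [intervalVec_self, smul_zero, sub_zero]
      exact sum_mem fun I hI => mem_K (hkept hI) (hc I)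
  rw [hcut.sum_add_smul_eq hF]
  exact add_mem (add_mem htrade
    (sum_mem fun a ha => mem_K (hnew (Finset.mem_insert_of_mem ha)) (hc _)))
    (mem_K (hnew (Finset.mem_insert_self s L)) (by linarith))

theorem exists_isTiltingFamily_mem_hull (o : ℕ → Prop) {x : ℕ → ℝ} (hx : ∀ t ∈ S, 0 ≤ x t)
    (n : ℕ) : ∃ F, IsTiltingFamily o S n F ∧
      Set.indicator (S ∩ Set.Iio n) x ∈ PointedCone.hull ℝ (intervalVec '' (F : Set (ℕ × ℕ))) := by
  induction n with
  | zero =>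
    refine ⟨∅, ⟨by simp, by simp, by simp, by simp, by simp, by simp⟩, ?_⟩
    have h0 : Set.indicator (S ∩ Set.Iio 0) x = 0 := by ext; simp
    exact h0 ▸ zero_mem _
  | succ n ih =>
    obtain ⟨F, hF, hxF⟩ := ih
    by_cases hn : n ∈ S
    swap
    · exact ⟨F, hF.succ_of_notMem hn, by rwa [inter_Iio_succ_of_notMem hn]⟩
    obtain ⟨c, hc⟩ := Submodule.mem_span_image_finset_iff_exists_fun' _ |>.1 hxF
    obtain ⟨L, s, hcut, hle, hge⟩ := exists_isCut o hF.notMem_lastStarts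
      (fun a => (c (a, n) : ℝ)) (hx n hn)
    refine ⟨_, hcut.isTiltingFamily hF hn, ?_⟩
    have hsplit : Set.indicator (S ∩ Set.Iio (n + 1)) x =
        ∑ I ∈ F, (c I : ℝ) • intervalVec I + x n • intervalVec (n, n + 1) := by
      have hdisj : Disjoint (S ∩ Set.Iio n) {n} := by simp
      calc Set.indicator (S ∩ Set.Iio (n + 1)) x
          = Set.indicator (S ∩ Set.Iio n) x + Set.indicator {n} x := by
            rw [inter_Iio_succ_of_mem hn, ← Set.union_singleton,
              Set.indicator_union_of_disjoint hdisj]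
            rfl
        _ = _ := by
            rw [← hc, Set.indicator_singleton, intervalVec_self_succ, ← Pi.single_smul,
              smul_eq_mul, mul_one]
            rfl
    rw [hsplit]
    exact hcut.sum_add_smul_mem_hull hF (fun I => (c I).2) hle hge

end TiltingFamilies

section Biproducts

variable {k : Type u} [Field k] {V : Type w} {Q : Quiver.{v} V}

lemma QRep.homAt_sum {M N : QRep k Q} {κ : Type*} (s : Finset κ) (f : κ → (M ⟶ N)) (i : V)
    (x : M.space i) : QRep.homAt (∑ j ∈ s, f j) i x = ∑ j ∈ s, QRep.homAt (f j) i x := by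
  induction s using Finset.cons_induction with
  | empty => simp
  | cons a s ha ih =>
    rw [Finset.sum_cons, Finset.sum_cons, ← ih]
    rfl

lemma IsFinDim.mem_supp_iff {M : QRep k Q} (hM : IsFinDim M) {i : V} :
    i ∈ supp M ↔ Nontrivial (M.space i) := by
  have := hM i
  change Module.finrank k (M.space i) ≠ 0 ↔ _
  rw [← Nat.pos_iff_ne_zero, Module.finrank_pos_iff]

variable {ι : Type} {X : ι → QRep k Q} [HasBiproduct X]

lemma isIndecSummand_biproduct {j : ι} (hX : Indecomposable (X j)) :
    IsIndecSummand (X j) (⨁ X) := by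
  classical
  exact ⟨hX, exists_iso_biprod_of_retraction (biproduct.ι X j) (biproduct.π X j)
    (biproduct.ι_π_self X j)⟩

variable [Finite ι]

variable (X) in
lemma homAt_biproduct_π_injective (i : V) :
    Function.Injective fun (x : (⨁ X).space i) j => QRep.homAt (biproduct.π X j) i x := by
  cases nonempty_fintype ι
  have htotal (z : (⨁ X).space i) :
      ∑ j, QRep.homAt (biproduct.ι X j) i (QRep.homAt (biproduct.π X j) i z) = z := by
    have := congrArg (QRep.homAt · i z) (biproduct.total (f := X))
    simpa only [QRep.homAt_sum, QRep.homAt_comp, QRep.homAt_id] using this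
  intro x y hxy
  rw [← htotal x, ← htotal y]
  exact Finset.sum_congr rfl fun j _ => congrArg _ (congrFun hxy j)

lemma isFinDim_biproduct (hX : ∀ j, IsFinDim (X j)) : IsFinDim (⨁ X) := fun i =>
  have := fun j => hX j i
  FiniteDimensional.of_injective (LinearMap.pi fun j => QRep.homAt (biproduct.π X j) i)
    (homAt_biproduct_π_injective X i)

lemma supp_biproduct (hX : ∀ j, IsFinDim (X j)) : supp (⨁ X) = ⋃ j, supp (X j) := by
  classical
  ext i
  simp only [Set.mem_iUnion, (isFinDim_biproduct hX).mem_supp_iff, (hX _).mem_supp_iff]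
  refine ⟨fun h => ?_, fun ⟨j, hj⟩ => ?_⟩
  · by_contra! h'
    exact not_subsingleton _ (homAt_biproduct_π_injective X i).subsingleton
  · refine Function.Injective.nontrivial (f := QRep.homAt (biproduct.ι X j) i) ?_
    refine Function.LeftInverse.injective (g := QRep.homAt (biproduct.π X j) i) fun x => ?_
    rw [← QRep.homAt_comp, biproduct.ι_π_self, QRep.homAt_id]

lemma isRigid_biproduct
    (h : letI : HasExt (QRep k Q) := HasExt.standard (QRep k Q)
      ∀ i j, Subsingleton (Abelian.Ext (X i) (X j) 1)) : IsRigid (⨁ X) := by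
  let : HasExt (QRep k Q) := HasExt.standard (QRep k Q)
  cases nonempty_fintype ι
  have (i : ι) : Subsingleton (Abelian.Ext (X i) (⨁ X) 1) :=
    have := h i
    (Abelian.Ext.addEquivBiproduct (X i) (biproduct.isBilimit X) 1).toEquiv.subsingleton
  exact (Abelian.Ext.biproductAddEquiv (biproduct.isBilimit X) (⨁ X) 1).toEquiv.subsingleton

lemma IsRigid.of_iso {M N : QRep k Q} (hM : IsRigid M) (e : M ≅ N) : IsRigid N := by
  let : HasExt (QRep k Q) := HasExt.standard (QRep k Q)
  have hM' : Subsingleton (Abelian.Ext M M 1) := hM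
  refine subsingleton_of_forall_eq 0 fun x => ?_
  have hx : ((Abelian.Ext.mk₀ e.hom).comp x (zero_add 1)).comp (Abelian.Ext.mk₀ e.inv)
      (add_zero 1) = 0 := Subsingleton.elim _ _
  calc x = (Abelian.Ext.mk₀ e.inv).comp ((((Abelian.Ext.mk₀ e.hom).comp x (zero_add 1)).comp
        (Abelian.Ext.mk₀ e.inv) (add_zero 1)).comp (Abelian.Ext.mk₀ e.hom) (add_zero 1))
        (zero_add 1) := by simp
    _ = 0 := by rw [hx, Abelian.Ext.zero_comp, Abelian.Ext.comp_zero]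

end Biproducts

section IntervalModules

attribute [local instance] Abelian.hasFiniteBiproducts

variable {k : Type u} [Field k] {V : Type w} {Q : Quiver.{v} V} {pos : V → ℕ} {o : ℕ → Prop}
  {F : Finset (ℕ × ℕ)}

lemma supp_thinRep (I : Set V) : supp (thinRep k Q I) = I := by
  classical
  ext i
  simp [supp, dimVec_thinRep]

lemma realDimVec_thinRep (I : Set V) : realDimVec (thinRep k Q I) = Set.indicator I 1 := by
  classical
  ext i
  simp [realDimVec, dimVec_thinRep, Set.indicator_apply]

lemma eq_of_posIco_eq {I J : ℕ × ℕ} (hI : I.1 < I.2) (hJ : J.1 < J.2)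
    (hIpos : Set.Ico I.1 I.2 ⊆ Set.range pos) (hJpos : Set.Ico J.1 J.2 ⊆ Set.range pos)
    (h : posIco pos I = posIco pos J) : I = J := by
  have hIJ : Set.Ico I.1 I.2 = Set.Ico J.1 J.2 :=
    calc Set.Ico I.1 I.2 = pos '' posIco pos I := (Set.image_preimage_eq_of_subset hIpos).symm
      _ = pos '' posIco pos J := by rw [h]
      _ = Set.Ico J.1 J.2 := Set.image_preimage_eq_of_subset hJpos
  have hle := (Set.Ico_subset_Ico_iff hI).1 hIJ.subset
  have hge := (Set.Ico_subset_Ico_iff hJ).1 hIJ.superset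
  exact Prod.ext (le_antisymm hge.1 hle.1) (le_antisymm hle.2 hge.2)

variable (k Q pos F) in
/-- The direct sum of the interval modules of a finite family of half-open intervals. -/
abbrev intervalModule : QRep k Q :=
  ⨁ fun I : F => thinRep k Q (posIco pos I.1)

lemma IsLinear.isTilting_of_iso (hQ : IsLinear Q pos o) (hlt : ∀ I ∈ F, I.1 < I.2)
    (hpos : ∀ I ∈ F, Set.Ico I.1 I.2 ⊆ Set.range pos) (hext : ∀ I ∈ F, ∀ J ∈ F, ExtVanish o I J)
    (hcard : Nat.card V = F.card) {T : QRep k Q} (e : intervalModule k Q pos F ≅ T) :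
    IsTilting T := by
  refine ⟨(isFinDim_biproduct fun _ => isFinDim_thinRep _).of_iso e, ?_, ?_⟩
  · let : HasExt (QRep k Q) := HasExt.standard (QRep k Q)
    exact (isRigid_biproduct (X := fun I : F => thinRep k Q (posIco pos I.1)) fun I J =>
      hQ.subsingleton_ext_one (hext I.1 I.2 J.1 J.2)).of_iso e
  let ε : Fin (Nat.card V) ≃ F := (finCongr hcard).trans F.equivFin.symm
  refine ⟨fun i => thinRep k Q (posIco pos (ε i).1),
    fun i => hQ.indecomposable_thinRep (hlt _ (ε i).2) (hpos _ (ε i).2),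
    fun i j hij => ⟨fun α => hij (ε.injective (Subtype.ext ?_))⟩,
    ⟨e.symm ≪≫ (biproduct.whiskerEquiv ε fun i => Iso.refl _).symm⟩⟩
  refine eq_of_posIco_eq (hlt _ (ε i).2) (hlt _ (ε j).2) (hpos _ (ε i).2) (hpos _ (ε j).2) ?_
  have hdim := dimVec_eq_of_iso α
  rw [← supp_thinRep (k := k) (Q := Q) (posIco pos (ε i).1), supp, hdim]
  exact supp_thinRep _

lemma IsLinear.fullSubquiver (hQ : IsLinear Q pos o) (S : Set V) :
    IsLinear (QuiverTilting.fullSubquiver Q S) (fun i => pos i) o where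
  injective := hQ.injective.comp Subtype.val_injective
  subsingleton i j := hQ.subsingleton i.1 j.1
  hom f := hQ.hom f
  up h := hQ.up h
  down h := hQ.down h

variable (k Q) in
/-- Restriction to a full subquiver, as a functor. -/
def restrictFunctor (S : Set V) : QRep k Q ⥤ QRep k (fullSubquiver Q S) :=
  letI := QuiverTilting.fullSubquiver Q S
  (Functor.whiskeringLeft _ _ _).obj (pathsInclusion Q S)

instance (S : Set V) : (restrictFunctor k Q S).Additive where
  map_add := rfl

/-- The restriction of a thin representation is thin. -/
def restrictThinRep (I S : Set V) :
    restrict (thinRep k Q I) S ≅ thinRep k (fullSubquiver Q S) (Subtype.val ⁻¹' I) :=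
  letI := QuiverTilting.fullSubquiver Q S
  Paths.liftNatIso (fun _ => Iso.refl _) fun _ => rfl

/-- The restriction of a sum of interval modules is the sum of the restricted interval modules. -/
def restrictIntervalModule (S : Set V) : restrict (intervalModule k Q pos F) S ≅
    intervalModule k (fullSubquiver Q S) (fun i => pos i) F :=
  (restrictFunctor k Q S).mapBiproduct _ ≪≫ biproduct.mapIso fun _ => restrictThinRep _ S

end IntervalModules

section TypeA

attribute [local instance] Abelian.hasFiniteBiproducts

variable {k : Type u} [Field k] {n : ℕ} {Q : Quiver.{v} (Fin n)} {o : ℕ → Prop} {S : Set ℕ}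
  {F : Finset (ℕ × ℕ)}

lemma IsTypeA.subsingleton_hom (hQ : IsTypeA Q) (i j : Fin n) : Subsingleton (Q.Hom i j) := by
  refine ⟨fun f g => ?_⟩
  rcases hQ.adjacent i j ⟨f⟩ with h | h
  · obtain ⟨hu⟩ := hQ.existsUnique_arrow i j h
    exact Sum.inl_injective (Subsingleton.elim (α := Q.Hom i j ⊕ Q.Hom j i) _ _)
  · obtain ⟨hu⟩ := hQ.existsUnique_arrow j i h
    exact Sum.inr_injective (Subsingleton.elim (α := Q.Hom j i ⊕ Q.Hom i j) _ _)

lemma IsTypeA.nonempty_hom_iff (hQ : IsTypeA Q) {i j : Fin n} (h : (i : ℕ) + 1 = j) :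
    Nonempty (Q.Hom j i) ↔ ¬Nonempty (Q.Hom i j) := by
  obtain ⟨hu⟩ := hQ.existsUnique_arrow i j h
  refine ⟨fun ⟨f⟩ ⟨g⟩ => Sum.inl_ne_inr (Subsingleton.elim (Sum.inl g) (Sum.inr f)),
    fun hij => ?_⟩
  rcases hu.default with f | f
  exacts [(hij ⟨f⟩).elim, ⟨f⟩]

lemma IsTypeA.exists_isLinear (hQ : IsTypeA Q) : ∃ o, IsLinear Q Fin.val o := by
  let o (t : ℕ) : Prop := ∃ i j : Fin n, (i : ℕ) + 1 = j ∧ j = t ∧ Nonempty (Q.Hom i j)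
  have ho {i j : Fin n} (h : (i : ℕ) + 1 = j) : o j ↔ Nonempty (Q.Hom i j) := by
    refine ⟨fun ⟨i', j', h', hj, hom⟩ => ?_, fun hom => ⟨i, j, h, rfl, hom⟩⟩
    obtain rfl : j' = j := Fin.ext hj
    obtain rfl : i' = i := Fin.ext (by omega)
    exact hom
  exact ⟨o, {
    injective := Fin.val_injective
    subsingleton := hQ.subsingleton_hom
    hom := fun f => (hQ.adjacent _ _ ⟨f⟩).imp (fun h => ⟨h, (ho h).2 ⟨f⟩⟩)
      fun h => ⟨h, (ho h).not.2 ((hQ.nonempty_hom_iff h).1 ⟨f⟩)⟩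
    up := fun h => (ho h).1
    down := fun h hno => (hQ.nonempty_hom_iff h).2 ((ho h).not.1 hno) }⟩

/-- The vector in `ℝⁿ` with entries `1` on a half-open interval and `0` elsewhere: a positive root
if the interval is a nonempty subset of `[0, n)`. -/
def rootVec (n : ℕ) (I : ℕ × ℕ) : Fin n → ℝ := fun i => intervalVec I i

lemma rootVec_eq_indicator (I : ℕ × ℕ) : rootVec n I = Set.indicator (posIco Fin.val I) 1 := rfl

lemma rootVec_self_succ (j : Fin n) : rootVec n (j, j + 1) = Pi.single j 1 := by
  ext i
  simp [rootVec, intervalVec_self_succ, Pi.single_apply, Fin.ext_iff]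

lemma mem_posRoots_iff {d : Fin n → ℝ} :
    d ∈ posRoots n ↔ ∃ I : ℕ × ℕ, I.1 < I.2 ∧ I.2 ≤ n ∧ d = rootVec n I := by
  constructor
  · rintro ⟨i, j, hij, rfl⟩
    have hIcc : Set.Icc i j = posIco Fin.val ((i : ℕ), (j : ℕ) + 1) :=
      Set.ext fun _ => and_congr Iff.rfl Nat.lt_succ_iff.symm
    exact ⟨(i, j + 1), Nat.lt_succ_of_le hij, j.2, by rw [rootVec_eq_indicator, ← hIcc]⟩
  · rintro ⟨⟨a, b⟩, hab, hbn, rfl⟩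
    have hb : b - 1 < n := (Nat.sub_one_lt (Nat.ne_zero_of_lt hab)).trans_le hbn
    have hIcc : posIco Fin.val (a, b) = Set.Icc (⟨a, hab.trans_le hbn⟩ : Fin n) ⟨b - 1, hb⟩ := by
      ext t
      simp [Fin.le_def, Nat.le_sub_one_iff_lt (Nat.zero_lt_of_lt hab)]
    exact ⟨_, _, Nat.le_sub_one_of_lt hab, by rw [rootVec_eq_indicator, hIcc]⟩

lemma IsLinear.summandDims_subset (hQ : IsLinear Q Fin.val o) (T : QRep k Q) :
    summandDims T ⊆ posRoots n := by
  rintro d ⟨N, ⟨hN, -⟩, rfl⟩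
  obtain ⟨a, m, ham, ⟨e⟩⟩ := exists_iso_thinRep hQ hN
  refine mem_posRoots_iff.2 ⟨(a, m + 1), Nat.lt_succ_of_le ham, m.2, ?_⟩
  rw [rootVec_eq_indicator, ← realDimVec_thinRep (k := k) (Q := Q)]
  ext i
  exact congrArg Nat.cast (congrFun (dimVec_eq_of_iso e) i)

namespace IsTiltingFamily

lemma Ico_subset_image (hF : IsTiltingFamily o S n F) {I : ℕ × ℕ} (hI : I ∈ F) :
    Set.Ico I.1 I.2 ⊆ Fin.val '' (Fin.val ⁻¹' S : Set (Fin n)) := fun t ht =>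
  ⟨⟨t, ht.2.trans_le (hF.le I hI)⟩, hF.subset I hI ht, rfl⟩

lemma nat_card_eq (hF : IsTiltingFamily o S n F) :
    Nat.card (Fin.val ⁻¹' S : Set (Fin n)) = F.card := by
  rw [hF.card, Nat.card_coe_set_eq, ← Set.ncard_image_of_injective _ Fin.val_injective,
    Set.image_preimage_eq_inter_range, Fin.range_val]

lemma supp_intervalModule (hF : IsTiltingFamily o S n F) :
    supp (intervalModule k Q Fin.val F) = Fin.val ⁻¹' S := by
  rw [supp_biproduct fun _ => isFinDim_thinRep _]
  ext i
  simp only [supp_thinRep, Set.mem_iUnion, Set.mem_preimage, Subtype.exists, exists_prop]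
  exact ⟨fun ⟨I, hI, hi⟩ => hF.subset I hI hi, fun hi => hF.cover i i.2 hi⟩

lemma isSupportTilting (hF : IsTiltingFamily o S n F) (hQ : IsLinear Q Fin.val o) :
    IsSupportTilting (intervalModule k Q Fin.val F) := by
  refine ⟨isFinDim_biproduct fun _ => isFinDim_thinRep _, ?_⟩
  rw [hF.supp_intervalModule]
  refine (hQ.fullSubquiver _).isTilting_of_iso hF.lt (fun I hI => ?_) hF.extVanish hF.nat_card_eq
    (restrictIntervalModule _).symm
  rw [Set.range_comp' Fin.val, Subtype.range_val]
  exact hF.Ico_subset_image hI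

lemma isTilting (hF : IsTiltingFamily o Set.univ n F) (hQ : IsLinear Q Fin.val o) :
    IsTilting (intervalModule k Q Fin.val F) :=
  hQ.isTilting_of_iso hF.lt
    (fun I hI => (hF.Ico_subset_image hI).trans (Set.image_subset_range _ _)) hF.extVanish
    (by rw [← hF.nat_card_eq, Set.preimage_univ, Nat.card_congr (Equiv.Set.univ _)]) (Iso.refl _)

lemma rootVec_mem_summandDims (hF : IsTiltingFamily o S n F) (hQ : IsLinear Q Fin.val o)
    {I : ℕ × ℕ} (hI : I ∈ F) : rootVec n I ∈ summandDims (intervalModule k Q Fin.val F) :=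
  ⟨_, isIndecSummand_biproduct (j := (⟨I, hI⟩ : F)) (hQ.indecomposable_thinRep (hF.lt I hI)
    ((hF.Ico_subset_image hI).trans (Set.image_subset_range _ _))), (realDimVec_thinRep _).symm⟩

end IsTiltingFamily

end TypeA

section Convexity

open scoped Pointwise

variable {E : Type*} [AddCommGroup E] [Module ℝ E]

lemma mem_smul_convexHull_of_mem_hull {A : Set E} {φ : E →ₗ[ℝ] ℝ} (hA : ∀ y ∈ A, φ y = 1) {x : E}
    (hx : x ∈ PointedCone.hull ℝ A) : 0 ≤ φ x ∧ x ∈ φ x • convexHull ℝ (A ∪ {0}) := by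
  have hconv := convex_convexHull ℝ (A ∪ {0})
  have h0 : (0 : E) ∈ convexHull ℝ (A ∪ {0}) := subset_convexHull ℝ _ (.inr rfl)
  induction hx using Submodule.span_induction with
  | mem y hy =>
    rw [hA y hy, one_smul]
    exact ⟨zero_le_one, subset_convexHull ℝ _ (.inl hy)⟩
  | zero => exact ⟨by simp, 0, h0, by simp⟩
  | add y z _ _ hy hz =>
    rw [map_add, hconv.add_smul hy.1 hz.1]
    exact ⟨add_nonneg hy.1 hz.1, Set.add_mem_add hy.2 hz.2⟩
  | smul r y _ hy =>
    have hφ : φ (r • y) = r * φ y := φ.map_smul (r : ℝ) y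
    rw [hφ, mul_smul]
    exact ⟨mul_nonneg r.2 hy.1, Set.smul_mem_smul_set hy.2⟩

/-- The functional `φ` cuts out the simplex on `A` and `0` from the cone over `A`. -/
lemma mem_convexHull_union_zero_of_mem_hull {A R : Set E} {φ : E →ₗ[ℝ] ℝ} (hA : ∀ y ∈ A, φ y = 1)
    (hR : ∀ y ∈ R, φ y ≤ 1) {x : E} (hx : x ∈ PointedCone.hull ℝ A) (hxR : x ∈ convexHull ℝ R) :
    x ∈ convexHull ℝ (A ∪ {0}) := by
  obtain ⟨hφ, y, hy, hyx⟩ := mem_smul_convexHull_of_mem_hull hA hx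
  have hφ1 : φ x ≤ 1 := convexHull_min hR (convex_halfSpace_le φ.isLinear 1) hxR
  rw [← hyx]
  exact (convex_convexHull ℝ _).smul_mem_of_zero_mem (subset_convexHull ℝ _ (.inr rfl)) hy
    ⟨hφ, hφ1⟩

lemma zero_mem_convexHull_of_neg_mem {A : Set E} {y : E} (hy : y ∈ A) (hy' : -y ∈ A) :
    0 ∈ convexHull ℝ A := by
  rw [← midpoint_self_neg ℝ y]
  exact (convex_convexHull ℝ A).midpoint_mem (subset_convexHull ℝ A hy) (subset_convexHull ℝ A hy')

end Convexity

section RootFunctionals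

variable {n : ℕ} {o : ℕ → Prop} {S S' : Set ℕ} {F F' : Finset (ℕ × ℕ)}

lemma exists_isTiltingFamily_rootVec (o : ℕ → Prop) {x : Fin n → ℝ}
    (hx : ∀ i : Fin n, (i : ℕ) ∈ S → 0 ≤ x i) :
    ∃ F, IsTiltingFamily o S n F ∧ Set.indicator (Fin.val ⁻¹' S) x ∈
      PointedCone.hull ℝ (rootVec n '' (F : Set (ℕ × ℕ))) := by
  let y : ℕ → ℝ := Function.extend Fin.val x 0
  have hyx (i : Fin n) : y i = x i := Fin.val_injective.extend_apply x 0 i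
  have hy : ∀ t ∈ S, 0 ≤ y t := fun t ht => by
    by_cases h : t < n
    · exact (hx ⟨t, h⟩ ht).trans_eq (hyx ⟨t, h⟩).symm
    · rw [show y t = 0 from Function.extend_apply' _ _ _ fun ⟨i, hi⟩ => h (hi ▸ i.2)]
  obtain ⟨F, hF, hyF⟩ := exists_isTiltingFamily_mem_hull o hy n
  refine ⟨F, hF, ?_⟩
  let res : (ℕ → ℝ) →ₗ[{r : ℝ // 0 ≤ r}] (Fin n → ℝ) :=
    (LinearMap.funLeft ℝ ℝ Fin.val).restrictScalars _
  have hres : res (Set.indicator (S ∩ Set.Iio n) y) = Set.indicator (Fin.val ⁻¹' S) x := by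
    classical
    ext i
    change Set.indicator (S ∩ Set.Iio n) y i = _
    simp [Set.indicator_apply, hyx]
  have hmem := Submodule.apply_mem_span_image_of_mem_span res hyF
  rw [Set.image_image, hres] at hmem
  exact hmem

/-- The linear functional on `ℝⁿ` with the given coefficients. -/
def coeffFunctional (n : ℕ) (u : ℕ → ℝ) : (Fin n → ℝ) →ₗ[ℝ] ℝ :=
  Fintype.linearCombination ℝ fun i : Fin n => u i

lemma coeffFunctional_single (u : ℕ → ℝ) (j : Fin n) :
    coeffFunctional n u (Pi.single j 1) = u j := by
  rw [coeffFunctional, Fintype.linearCombination_apply_single, one_smul]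

lemma coeffFunctional_rootVec (u : ℕ → ℝ) {I : ℕ × ℕ} (hI : I.2 ≤ n) :
    coeffFunctional n u (rootVec n I) = ∑ t ∈ Finset.Ico I.1 I.2, u t := by
  classical
  have hIco : (Finset.range n).filter (· ∈ Set.Ico I.1 I.2) = Finset.Ico I.1 I.2 := by
    ext t
    simp only [Finset.mem_filter, Finset.mem_range, Set.mem_Ico, Finset.mem_Ico]
    omega
  simp only [coeffFunctional, Fintype.linearCombination_apply, rootVec, smul_eq_mul]
  rw [Fin.sum_univ_eq_sum_range (fun t => intervalVec I t * u t), ← hIco, Finset.sum_filter]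
  simp [intervalVec, Set.indicator_apply]

lemma sum_Ico_sub_succ (q : ℕ → ℝ) {I : ℕ × ℕ} (hlt : I.1 < I.2) :
    ∑ t ∈ Finset.Ico I.1 I.2, (q t - q (t + 1)) = q I.1 - q I.2 := by
  rw [← neg_inj, ← Finset.sum_neg_distrib, neg_sub, ← Finset.sum_Ico_sub q hlt.le]
  exact Finset.sum_congr rfl fun t _ => neg_sub _ _

/-- `φ` takes a root to the difference of the values at its ends of the indicator function of the
set of left ends of intervals in `F` and right ends of intervals in `F'`. -/
lemma exists_functional_of_disjoint (hS : Disjoint S S') (hF : IsTiltingFamily o S n F)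
    (hF' : IsTiltingFamily o S' n F') :
    ∃ φ : (Fin n → ℝ) →ₗ[ℝ] ℝ, (∀ y ∈ posRoots n, φ y ≤ 1 ∧ -1 ≤ φ y) ∧
      (∀ I ∈ F, φ (rootVec n I) = 1) ∧ ∀ I ∈ F', φ (rootVec n I) = -1 := by
  classical
  let q (t : ℕ) : ℝ := if (∃ I ∈ F, I.1 = t) ∨ (∃ I ∈ F', I.2 = t) then 1 else 0
  have hq0 (t : ℕ) : 0 ≤ q t := by simp only [q]; split_ifs <;> norm_num
  have hq1 (t : ℕ) : q t ≤ 1 := by simp only [q]; split_ifs <;> norm_num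
  have hφ {I : ℕ × ℕ} (hlt : I.1 < I.2) (hI : I.2 ≤ n) :
      coeffFunctional n (fun t => q t - q (t + 1)) (rootVec n I) = q I.1 - q I.2 := by
    rw [coeffFunctional_rootVec _ hI, sum_Ico_sub_succ q hlt]
  have hends {I J : ℕ × ℕ} (hI : I ∈ F) (hJ : J ∈ F') : I.1 ≠ J.1 ∧ I.2 ≠ J.2 := by
    have hIlt := hF.lt I hI
    have hJlt := hF'.lt J hJ
    have hdisj (t : ℕ) (ht : t ∈ Set.Ico I.1 I.2) : t ∉ Set.Ico J.1 J.2 := fun ht' =>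
      Set.disjoint_left.1 hS (hF.subset I hI ht) (hF'.subset J hJ ht')
    have hleft := hdisj I.1
    have hright := hdisj (I.2 - 1)
    simp only [Set.mem_Ico] at hleft hright
    omega
  refine ⟨coeffFunctional n fun t => q t - q (t + 1), fun y hy => ?_, fun I hI => ?_,
    fun I hI => ?_⟩
  · obtain ⟨I, hlt, hI, rfl⟩ := mem_posRoots_iff.1 hy
    rw [hφ hlt hI]
    constructor <;> linarith [hq0 I.1, hq1 I.1, hq0 I.2, hq1 I.2]
  · have hq : q I.1 = 1 := if_pos (.inl ⟨I, hI, rfl⟩)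
    have hq' : q I.2 = 0 := if_neg <| not_or.2
      ⟨fun ⟨J, hJ, h⟩ => (hF.extVanish I hI J hJ).1 h.symm,
        fun ⟨J, hJ, h⟩ => (hends hI hJ).2 h.symm⟩
    rw [hφ (hF.lt I hI) (hF.le I hI), hq, hq', sub_zero]
  · have hq : q I.1 = 0 := if_neg <| not_or.2
      ⟨fun ⟨J, hJ, h⟩ => (hends hJ hI).1 h, fun ⟨J, hJ, h⟩ => (hF'.extVanish J hJ I hI).1 h⟩
    have hq' : q I.2 = 1 := if_pos (.inr ⟨I, hI, rfl⟩)
    rw [hφ (hF'.lt I hI) (hF'.le I hI), hq, hq', zero_sub]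

/-- The functional of `exists_functional_of_disjoint` for the empty family `F'`, with its
coefficients off `S` lowered to `-1`. -/
lemma exists_functional_of_simpleRoots (hF : IsTiltingFamily o S n F) :
    ∃ φ : (Fin n → ℝ) →ₗ[ℝ] ℝ, (∀ y ∈ posRoots n, φ y ≤ 1) ∧
      (∀ j, -1 ≤ φ (Pi.single j 1)) ∧ (∀ I ∈ F, φ (rootVec n I) = 1) ∧
      ∀ j : Fin n, (j : ℕ) ∉ S → φ (Pi.single j 1) = -1 := by
  classical
  let q (t : ℕ) : ℝ := if ∃ I ∈ F, I.1 = t then 1 else 0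
  let u (t : ℕ) : ℝ := if t ∈ S then q t - q (t + 1) else -1
  have hq0 (t : ℕ) : 0 ≤ q t := by simp only [q]; split_ifs <;> norm_num
  have hq1 (t : ℕ) : q t ≤ 1 := by simp only [q]; split_ifs <;> norm_num
  have hu (t : ℕ) : -1 ≤ u t ∧ u t ≤ q t - q (t + 1) := by
    simp only [u]
    split_ifs <;> constructor <;> linarith [hq0 t, hq1 t, hq0 (t + 1), hq1 (t + 1)]
  refine ⟨coeffFunctional n u, fun y hy => ?_, fun j => ?_, fun I hI => ?_, fun j hj => ?_⟩
  · obtain ⟨I, hlt, hI, rfl⟩ := mem_posRoots_iff.1 hy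
    calc coeffFunctional n u (rootVec n I) = ∑ t ∈ Finset.Ico I.1 I.2, u t :=
          coeffFunctional_rootVec u hI
      _ ≤ ∑ t ∈ Finset.Ico I.1 I.2, (q t - q (t + 1)) := Finset.sum_le_sum fun t _ => (hu t).2
      _ = q I.1 - q I.2 := sum_Ico_sub_succ q hlt
      _ ≤ 1 := by linarith [hq1 I.1, hq0 I.2]
  · rw [coeffFunctional_single]
    exact (hu j).1
  · have huI : ∀ t ∈ Finset.Ico I.1 I.2, u t = q t - q (t + 1) := fun t ht =>
      if_pos (hF.subset I hI (Finset.mem_Ico.1 ht))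
    have hq : q I.1 = 1 := if_pos ⟨I, hI, rfl⟩
    have hq' : q I.2 = 0 := if_neg fun ⟨J, hJ, h⟩ => (hF.extVanish I hI J hJ).1 h.symm
    rw [coeffFunctional_rootVec u (hF.le I hI), Finset.sum_congr rfl huI,
      sum_Ico_sub_succ q (hF.lt I hI), hq, hq', sub_zero]
  · rw [coeffFunctional_single]
    exact if_neg hj

end RootFunctionals

section Polytopes

variable {k : Type u} [Field k] {n : ℕ} {Q : Quiver.{v} (Fin n)} {o : ℕ → Prop}

lemma rootVec_nonneg (I : ℕ × ℕ) : 0 ≤ rootVec n I := fun _ =>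
  Set.indicator_nonneg (fun _ _ => zero_le_one) _

lemma nonneg_of_mem_polyCPlus {x : Fin n → ℝ} (hx : x ∈ polyCPlus n) : 0 ≤ x := by
  refine convexHull_min (Set.union_subset ?_ (by simp)) (convex_Ici 0) hx
  rintro y hy
  obtain ⟨I, -, -, rfl⟩ := mem_posRoots_iff.1 hy
  exact rootVec_nonneg I

lemma zero_mem_polyC (hn : 1 ≤ n) : 0 ∈ polyC n := by
  have h : rootVec n (0, 1) ∈ posRoots n := mem_posRoots_iff.2 ⟨_, zero_lt_one, hn, rfl⟩
  exact zero_mem_convexHull_of_neg_mem (.inl h) (.inr (by rwa [Set.mem_ofPred_eq, neg_neg]))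

lemma zero_mem_polyCClus (hn : 1 ≤ n) : 0 ∈ polyCClus n := by
  have h : rootVec n (0, 1) ∈ posRoots n := mem_posRoots_iff.2 ⟨_, zero_lt_one, hn, rfl⟩
  refine zero_mem_convexHull_of_neg_mem (.inl h) (.inr ⟨⟨0, hn⟩, ?_⟩)
  rw [neg_neg, ← rootVec_self_succ]

lemma mem_hull_union_image_neg {ι : Type*} {s : Set ι} {x : ι → ℝ} {A B : Set (ι → ℝ)}
    (hA : s.indicator x ∈ PointedCone.hull ℝ A) (hB : sᶜ.indicator (-x) ∈ PointedCone.hull ℝ B) :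
    x ∈ PointedCone.hull ℝ (A ∪ (-·) '' B) := by
  have hneg := Submodule.apply_mem_span_image_of_mem_span (-LinearMap.id) hB
  rw [LinearMap.neg_apply, LinearMap.id_apply, ← Set.indicator_neg', neg_neg] at hneg
  rw [← Set.indicator_self_add_compl s x]
  exact add_mem (Submodule.span_mono Set.subset_union_left hA)
    (Submodule.span_mono Set.subset_union_right hneg)

/-- The positions at which `x` is nonnegative. -/
def nonnegSet (x : Fin n → ℝ) : Set ℕ :=
  Fin.val '' {i | 0 ≤ x i}

lemma val_mem_nonnegSet {x : Fin n → ℝ} {i : Fin n} : (i : ℕ) ∈ nonnegSet x ↔ 0 ≤ x i :=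
  Fin.val_injective.mem_set_image

lemma indicator_mem_hull_single {ι : Type*} [Finite ι] [DecidableEq ι] {s : Set ι} {y : ι → ℝ}
    (hy : ∀ i ∈ s, 0 ≤ y i) :
    s.indicator y ∈ PointedCone.hull ℝ ((fun j => Pi.single j (1 : ℝ)) '' s) := by
  cases nonempty_fintype ι
  have hsum : s.indicator y = ∑ i, Pi.single i (s.indicator y i) :=
    (Finset.univ_sum_single _).symm
  rw [hsum]
  refine Submodule.sum_mem _ fun i _ => ?_
  by_cases hi : i ∈ s
  · have hsmul : Pi.single i (s.indicator y i) = (⟨y i, hy i hi⟩ : {r : ℝ // 0 ≤ r}) •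
        (Pi.single i 1 : ι → ℝ) := by
      rw [Set.indicator_of_mem hi, Nonneg.mk_smul, ← Pi.single_smul, smul_eq_mul, mul_one]
    rw [hsmul]
    exact Submodule.smul_mem _ _ (Submodule.subset_span (Set.mem_image_of_mem _ hi))
  · rw [Set.indicator_of_notMem hi, Pi.single_zero]
    exact Submodule.zero_mem _

lemma neg_nonneg_of_notMem_nonnegSet {x : Fin n → ℝ} {i : Fin n} (hi : (i : ℕ) ∉ nonnegSet x) :
    0 ≤ (-x) i :=
  neg_nonneg.2 (le_of_not_ge (mt val_mem_nonnegSet.2 hi))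

lemma exists_mem_hull_rootVec_union_neg_single (o : ℕ → Prop) (x : Fin n → ℝ) :
    ∃ S F, IsTiltingFamily o S n F ∧ x ∈ PointedCone.hull ℝ
      (rootVec n '' F ∪ (-·) '' ((fun j : Fin n => Pi.single j (1 : ℝ)) '' {j | (j : ℕ) ∉ S})) := by
  obtain ⟨F, hF, hxF⟩ :=
    exists_isTiltingFamily_rootVec (S := nonnegSet x) o fun i => val_mem_nonnegSet.1
  exact ⟨nonnegSet x, F, hF, mem_hull_union_image_neg hxF <|
    indicator_mem_hull_single fun _ => neg_nonneg_of_notMem_nonnegSet⟩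

lemma exists_mem_hull_rootVec_union_neg_rootVec (o : ℕ → Prop) (x : Fin n → ℝ) :
    ∃ S F F', IsTiltingFamily o S n F ∧ IsTiltingFamily o Sᶜ n F' ∧
      x ∈ PointedCone.hull ℝ (rootVec n '' F ∪ (-·) '' (rootVec n '' F')) := by
  obtain ⟨F, hF, hxF⟩ :=
    exists_isTiltingFamily_rootVec (S := nonnegSet x) o fun i => val_mem_nonnegSet.1
  obtain ⟨F', hF', hxF'⟩ := exists_isTiltingFamily_rootVec (S := (nonnegSet x)ᶜ) o
    fun i => neg_nonneg_of_notMem_nonnegSet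
  exact ⟨nonnegSet x, F, F', hF, hF', mem_hull_union_image_neg hxF hxF'⟩

lemma IsLinear.polyPPlus_eq (hQ : IsLinear Q Fin.val o) : polyPPlus k Q = polyCPlus n := by
  refine Set.Subset.antisymm ?_ fun x hx => ?_
  · rintro x ⟨T, -, hx⟩
    exact convexHull_mono (Set.union_subset_union_left _ (hQ.summandDims_subset T)) hx
  · obtain ⟨F, hF, hxF⟩ := exists_isTiltingFamily_rootVec (S := Set.univ) o fun i _ =>
      nonneg_of_mem_polyCPlus hx i
    obtain ⟨φ, hφ, -, hφF, -⟩ := exists_functional_of_simpleRoots hF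
    rw [Set.preimage_univ, Set.indicator_univ] at hxF
    refine ⟨intervalModule k Q Fin.val F, hF.isTilting hQ, convexHull_mono
      (Set.union_subset_union_left _ ?_) (mem_convexHull_union_zero_of_mem_hull
      (Set.forall_mem_image.2 hφF) (R := posRoots n ∪ {0}) ?_ hxF hx)⟩
    · exact Set.image_subset_iff.2 fun I hI => hF.rootVec_mem_summandDims hQ hI
    · rintro y (hy | rfl)
      · exact hφ y hy
      · rw [map_zero]
        exact zero_le_one

lemma IsLinear.polyPClus_eq (hQ : IsLinear Q Fin.val o) (hn : 1 ≤ n) :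
    polyPClus k Q = polyCClus n := by
  have hsimple (j : Fin n) : (-Set.indicator {j} 1 : Fin n → ℝ) = -Pi.single j 1 := by
    rw [Set.indicator_singleton, Pi.one_apply]
  refine Set.Subset.antisymm ?_ fun x hx => ?_
  · rintro x ⟨T, -, hx⟩
    refine convexHull_min (Set.union_subset (Set.union_subset ?_ ?_) ?_)
      (convex_convexHull ℝ _) hx
    · exact fun d hd => subset_convexHull ℝ _ (.inl (hQ.summandDims_subset T hd))
    · rintro _ ⟨j, -, rfl⟩
      exact subset_convexHull ℝ _ (.inr ⟨j, by rw [hsimple, neg_neg]⟩)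
    · exact Set.singleton_subset_iff.2 (zero_mem_polyCClus hn)
  · obtain ⟨S, F, hF, hx'⟩ := exists_mem_hull_rootVec_union_neg_single o x
    obtain ⟨φ, hφ, hφs, hφF, hφS⟩ := exists_functional_of_simpleRoots hF
    refine ⟨intervalModule k Q Fin.val F, hF.isSupportTilting hQ, convexHull_mono
      (Set.union_subset_union_left _ (Set.union_subset_union ?_ ?_))
      (mem_convexHull_union_zero_of_mem_hull (φ := φ) ?_ ?_ hx' hx)⟩
    · exact Set.image_subset_iff.2 fun I hI => hF.rootVec_mem_summandDims hQ hI
    · rintro _ ⟨_, ⟨j, hj, rfl⟩, rfl⟩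
      exact ⟨j, by rwa [hF.supp_intervalModule], (hsimple j).symm⟩
    · rintro _ (⟨I, hI, rfl⟩ | ⟨_, ⟨j, hj, rfl⟩, rfl⟩)
      · exact hφF I hI
      · rw [map_neg, hφS j hj, neg_neg]
    · rintro y (hy | ⟨j, hj⟩)
      · exact hφ y hy
      · rw [← neg_neg y, hj, map_neg]
        exact neg_le.1 (hφs j)

lemma IsLinear.polyP_eq (hQ : IsLinear Q Fin.val o) (hn : 1 ≤ n) : polyP k Q = polyC n := by
  refine Set.Subset.antisymm ?_ fun x hx => ?_
  · rintro x ⟨T, T', -, hx⟩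
    refine convexHull_min (Set.union_subset (Set.union_subset ?_ ?_) ?_)
      (convex_convexHull ℝ _) hx
    · exact fun d hd => subset_convexHull ℝ _ (.inl (hQ.summandDims_subset T hd))
    · exact fun d hd => subset_convexHull ℝ _ (.inr (hQ.summandDims_subset T' hd))
    · exact Set.singleton_subset_iff.2 (zero_mem_polyC hn)
  · obtain ⟨S, F, F', hF, hF', hx'⟩ := exists_mem_hull_rootVec_union_neg_rootVec o x
    obtain ⟨φ, hφ, hφF, hφF'⟩ := exists_functional_of_disjoint disjoint_compl_right hF hF'
    refine ⟨intervalModule k Q Fin.val F, intervalModule k Q Fin.val F',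
      ⟨hF.isSupportTilting hQ, hF'.isSupportTilting hQ, ?_⟩, convexHull_mono
      (Set.union_subset_union_left _ (Set.union_subset_union ?_ ?_))
      (mem_convexHull_union_zero_of_mem_hull (φ := φ) ?_ ?_ hx' hx)⟩
    · rw [hF.supp_intervalModule, hF'.supp_intervalModule, Set.preimage_compl]
      exact isCompl_compl
    · exact Set.image_subset_iff.2 fun I hI => hF.rootVec_mem_summandDims hQ hI
    · rintro _ ⟨_, ⟨I, hI, rfl⟩, rfl⟩
      rw [Set.mem_ofPred_eq, neg_neg]
      exact hF'.rootVec_mem_summandDims hQ hI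
    · rintro _ (⟨I, hI, rfl⟩ | ⟨_, ⟨I, hI, rfl⟩, rfl⟩)
      · exact hφF I hI
      · rw [map_neg, hφF' I hI, neg_neg]
    · rintro y (hy | hy)
      · exact (hφ y hy).1
      · rw [← neg_neg y, map_neg]
        exact neg_le.1 (hφ _ hy).2

end Polytopes

end QuiverTilting

end

theorem mainTheorem1 {k : Type u} [Field k] {n : ℕ} (hn : 1 ≤ n)
    (Q : Quiver.{v} (Fin n)) (hQ : QuiverTilting.IsTypeA Q) :
    (QuiverTilting.polyP k Q = QuiverTilting.polyC n ∧
      QuiverTilting.polyPClus k Q = QuiverTilting.polyCClus n ∧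
      QuiverTilting.polyPPlus k Q = QuiverTilting.polyCPlus n) ∧
    (∀ Q' : Quiver.{v'} (Fin n), QuiverTilting.IsTypeA Q' →
      QuiverTilting.polyP k Q = QuiverTilting.polyP k Q' ∧
      QuiverTilting.polyPClus k Q = QuiverTilting.polyPClus k Q' ∧
      QuiverTilting.polyPPlus k Q = QuiverTilting.polyPPlus k Q') := by
  obtain ⟨o, ho⟩ := hQ.exists_isLinear
  refine ⟨⟨ho.polyP_eq hn, ho.polyPClus_eq hn, ho.polyPPlus_eq⟩, fun Q' hQ' => ?_⟩
  obtain ⟨o', ho'⟩ := hQ'.exists_isLinear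
  rw [ho.polyP_eq hn, ho.polyPClus_eq hn, ho.polyPPlus_eq, ho'.polyP_eq hn,
    ho'.polyPClus_eq hn, ho'.polyPPlus_eq]
  exact ⟨rfl, rfl, rfl⟩
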